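/- Let $\Bbbk$ be a field, let $G$ be a finite simple graph, and let $\pi=\{W_1,\ldots,W_r\}$ be a clique partition of $G$, i.e. each $W_i$ is a clique of $G$ and $V(G)$ is the disjoint union of $W_1,\ldots,W_r$. For positive integers $n_1,\ldots,n_r$ let $G^{\pi}[n_1,\ldots,n_r]$ be the multi-clique-whiskered graph: its vertex set is $V(G)\cup\{w_{i,k} : 1\le i\le r,\ 1\le k\le n_i\}$ with new vertices $w_{i,k}$, and its edges are those of $G$ together with all $\{x,w_{i,k}\}$ with $1\le i\le r$, $x\in W_i$ and $1\le k\le n_i$. Similarly, let $G^{\pi}$ be the clique-whiskered graph, with vertex set $V(G)\cup\{w_1,\ldots,w_r\}$ and edges those of $G$ together with all $\{x,w_i\}$ with $1\le i\le r$ and $x\in W_i$. For a finite simple graph $H$ let $S=\Bbbk[V(H)]$ be the standard graded polynomial ring whose variables $x_v$ are indexed by the vertices $v$ of $H$, and let $I(H)=(x_ux_v : \{u,v\}\in E(H))\subseteq S$ be the edge ideal. Let $\mathrm{im}(H)$ be the induced matching number, i.e. the largest size of a set $M$ of pairwise disjoint edges of $H$ such that no edge of $H$ outside $M$ is contained in the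 union of the edges in $M$. For a finitely generated graded $S$-module $N$ let $\mathrm{reg}\,N=\max\{j-i : \beta_{i,j}(N)\neq 0\}$ be its Castelnuovo–Mumford regularity, where the graded Betti number $\beta_{i,j}(N)$ is the number of summands $S(-j)$ in homological degree $i$ of a graded minimal free resolution of $N$. Then for all positive integers $n_1,\ldots,n_r$, $$\mathrm{reg}\bigl(S/I(G^{\pi}[n_1,\ldots,n_r])\bigr)=\mathrm{im}(G^{\pi}[n_1,\ldots,n_r]),\qquad S=\Bbbk[V(G^{\pi}[n_1,\ldots,n_r])].$$ This generalizes the clique-whiskered case ($n_1=\cdots=n_r=1$): $$\mathrm{reg}\bigl(S/I(G^{\pi})\bigr)=\mathrm{im}(G^{\pi}),\qquad S=\Bbbk[V(G^{\pi})].$$ -/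

import Mathlib

namespace SimpleGraph

variable {V : Type*}

/-- The edge ideal `I(G) = (x_u x_v : {u, v} ∈ E(G))` in the polynomial ring over `k` whose
variables are the vertices of `G`. -/
noncomputable def edgeIdeal (k : Type*) [CommRing k] (G : SimpleGraph V) : Ideal (MvPolynomial V k) :=
  Ideal.span {p | ∃ u v : V, G.Adj u v ∧ p = MvPolynomial.X u * MvPolynomial.X v}

/-- A finite set `M` of edges is an induced matching if no two of its members share a vertex and
no edge of `G` outside `M` is contained in the union of the members of `M`. -/
structure IsInducedMatching (G : SimpleGraph V) (M : Finset (Sym2 V)) : Prop where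
  subset_edgeSet : ∀ e ∈ M, e ∈ G.edgeSet
  disjoint : ∀ e ∈ M, ∀ f ∈ M, e ≠ f → ∀ v : V, ¬ (v ∈ e ∧ v ∈ f)
  induced : ∀ e ∈ G.edgeSet, (∀ v ∈ e, ∃ f ∈ M, v ∈ f) → e ∈ M

/-- The induced matching number `im(G)`: the largest size of an induced matching. It is used for
finite graphs, where the set below is non-empty and bounded, so that the supremum is a maximum. -/
noncomputable def inducedMatchingNumber (G : SimpleGraph V) : ℕ :=
  sSup {m | ∃ M : Finset (Sym2 V), G.IsInducedMatching M ∧ M.card = m}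

/-- `W_1, …, W_r` is a clique partition of `G`: each `W_i` is a clique, and `V(G)` is their
disjoint union. -/
structure IsCliquePartition (G : SimpleGraph V) {r : ℕ} (W : Fin r → Set V) : Prop where
  isClique : ∀ i, G.IsClique (W i)
  disjoint : ∀ i j, i ≠ j → Disjoint (W i) (W j)
  iUnion_eq : ⋃ i, W i = Set.univ

/-- The multi-clique-whiskered graph `G^π[n_1, …, n_r]`: to `G` one adds the new vertices
`w_{i,k}` (`1 ≤ i ≤ r`, `1 ≤ k ≤ n_i`) and joins `w_{i,k}` to all vertices of `W_i`. -/
def multiCliqueWhiskered (G : SimpleGraph V) {r : ℕ} (W : Fin r → Set V) (n : Fin r → ℕ) :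
    SimpleGraph (V ⊕ (Σ i : Fin r, Fin (n i))) where
  Adj
    | .inl u, .inl v => G.Adj u v
    | .inl u, .inr w => u ∈ W w.1
    | .inr w, .inl u => u ∈ W w.1
    | .inr _, .inr _ => False
  symm := ⟨by rintro (u | w) (v | w') h <;> first | exact h | exact G.adj_symm h⟩
  loopless := ⟨by rintro (u | w) h <;> first | exact h | exact G.irrefl h⟩

/-- The clique-whiskered graph `G^π`: to `G` one adds the new vertices `w_1, …, w_r` and joins
`w_i` to all vertices of `W_i`. -/
def cliqueWhiskered (G : SimpleGraph V) {r : ℕ} (W : Fin r → Set V) :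
    SimpleGraph (V ⊕ Fin r) where
  Adj
    | .inl u, .inl v => G.Adj u v
    | .inl u, .inr i => u ∈ W i
    | .inr i, .inl u => u ∈ W i
    | .inr _, .inr _ => False
  symm := ⟨by rintro (u | w) (v | w') h <;> first | exact h | exact G.adj_symm h⟩
  loopless := ⟨by rintro (u | w) h <;> first | exact h | exact G.irrefl h⟩

end SimpleGraph

namespace GradedRes

/-- The homogeneous polynomials of degree `j ∈ ℤ` for the standard grading of `S = k[x_s : s ∈ σ]`
(the zero submodule if `j < 0`). -/
noncomputable abbrev stdGrading (k σ : Type*) [CommRing k] (j : ℤ) :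
    Submodule k (MvPolynomial σ k) :=
  MvPolynomial.weightedHomogeneousSubmodule k (fun _ : σ => (1 : ℤ)) j

/-- The grading of `S / I` induced by the standard grading of `S`: its component of degree `j` is
the image of the homogeneous polynomials of degree `j`. -/
noncomputable def quotientGrading {k σ : Type*} [CommRing k] (I : Ideal (MvPolynomial σ k))
    (j : ℤ) : Submodule k (MvPolynomial σ k ⧸ I) :=
  (stdGrading k σ j).map (Ideal.Quotient.mkₐ k I).toLinearMap

/-- A graded minimal free resolution `⋯ → F_2 → F_1 → F_0 → M → 0` of an `S`-module `M` with
graded components `𝓜 j`, `j ∈ ℤ`, where `S = k[x_s : s ∈ σ]`.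

The module `F_i` is the finite free module with standard basis `e_{i,a}`, `a < rank i`, where
`e_{i,a}` has degree `deg i a`; thus `F_i = ⨁_a S(-deg i a)`. The maps preserve degrees, and all
entries of the matrices of the differentials lie in the ideal `(x_s : s ∈ σ)`. -/
structure MinimalGradedFreeResolution (k σ : Type*) [Field k] {M : Type*} [AddCommGroup M]
    [Module k M] [Module (MvPolynomial σ k) M] (𝓜 : ℤ → Submodule k M) where
  /-- the rank of `F_i` -/
  rank : ℕ → ℕ
  /-- the degrees of the basis elements of `F_i` -/
  deg : ∀ i, Fin (rank i) → ℤ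
  /-- the differential `F_{i+1} → F_i` -/
  d : ∀ i, (Fin (rank (i + 1)) → MvPolynomial σ k) →ₗ[MvPolynomial σ k]
    (Fin (rank i) → MvPolynomial σ k)
  /-- the augmentation `F_0 → M` -/
  aug : (Fin (rank 0) → MvPolynomial σ k) →ₗ[MvPolynomial σ k] M
  aug_surjective : Function.Surjective aug
  exact_aug : Function.Exact (d 0) aug
  exact_d : ∀ i, Function.Exact (d (i + 1)) (d i)
  aug_graded : ∀ a, aug (Pi.single a 1) ∈ 𝓜 (deg 0 a)
  d_graded : ∀ i a b, d i (Pi.single a 1) b ∈ stdGrading k σ (deg (i + 1) a - deg i b)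
  minimal : ∀ i a b,
    d i (Pi.single a 1) b ∈ Ideal.span (Set.range (MvPolynomial.X : σ → MvPolynomial σ k))

/-- The graded Betti number `β_{i,j}`: the number of summands `S(-j)` of `F_i`. -/
def MinimalGradedFreeResolution.betti {k σ : Type*} [Field k] {M : Type*} [AddCommGroup M]
    [Module k M] [Module (MvPolynomial σ k) M] {𝓜 : ℤ → Submodule k M}
    (F : MinimalGradedFreeResolution k σ 𝓜) (i : ℕ) (j : ℤ) : ℕ :=
  (Finset.univ.filter fun a : Fin (F.rank i) => F.deg i a = j).card

/-- `ρ` is the Castelnuovo–Mumford regularity `max {j - i : β_{i,j}(M) ≠ 0}` of the graded module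
`M`: a graded minimal free resolution of `M` exists, and whichever one is used to compute the
graded Betti numbers, `ρ` is the maximum. -/
def IsRegularity (k σ : Type*) [Field k] {M : Type*} [AddCommGroup M]
    [Module k M] [Module (MvPolynomial σ k) M] (𝓜 : ℤ → Submodule k M) (ρ : ℤ) : Prop :=
  Nonempty (MinimalGradedFreeResolution k σ 𝓜) ∧
    ∀ F : MinimalGradedFreeResolution k σ 𝓜,
      IsGreatest {e : ℤ | ∃ (i : ℕ) (j : ℤ), F.betti i j ≠ 0 ∧ e = j - i} ρ

end GradedRes

/-! ## Koszul complexes -/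

set_option linter.unusedSectionVars false

namespace Koszul

universe u v

variable {S : Type u} [CommRing S]

/-! The Koszul homology of `S / I` on the variables, in homological degree `i` with coefficients of
degree `q`, is non-zero exactly when `β_{i,i+q} ≠ 0` in any minimal graded free resolution
(`vanish_iff_betti_eq_zero`); such a resolution exists by `nonempty_minimalGradedFreeResolution`.
The regularity is thus the largest `q` for which `Vanish` fails for some `i`, and two bounds are
needed.

Upper bound (`IsWhiskered.vanishMon`). Every old vertex `x` has a whisker `w x` with `N[w x] ⊆
N[x]`, and every edge meets the set of old vertices. Split at `x` by `0 → S/(I:x)(-1) → S/I →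
S/(I,x) → 0`. The ideal `(I,x)` deletes `x` from the graph. The ideal `I:x` deletes `N[x]`, and
every induced matching of what is left extends by `{x, w x}`; the induced matching number has
therefore dropped by at least one, which pays for the shift. Both smaller graphs keep the whiskers
of their old vertices, and the induction ends at ideals generated by variables, where no homology
has `q > 0`.

Lower bound (`exists_not_vanish_of_isInducedMatching`), valid for every finite graph. For an induced
matching with edges `{x_i, y_i}`, the product of the `x_i e_{y_i}` is a Koszul cycle since `x_i y_i
∈ I`. A linear map to a quotient of `S` in which `x_i = y_i`, unmatched variables vanish and `x_i² =
0` kills all boundaries, but sends this cycle to `∏ x_i ≠ 0`.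

Both graphs of the theorem are instances of `IsWhiskered`. -/

/-- The underlying type of the Koszul complex of `M` with respect to a list of ring elements:
adding an element `s` to the list replaces `K` by `K ⊕ K e_s`. -/
def Kos (M : Type v) : List S → Type v
  | [] => M
  | _ :: l => Kos M l × Kos M l

instance instAddCommGroup (M : Type v) [AddCommGroup M] : ∀ l : List S, AddCommGroup (Kos M l)
  | [] => inferInstanceAs (AddCommGroup M)
  | _ :: l =>
    letI := instAddCommGroup M l
    inferInstanceAs (AddCommGroup (Kos M l × Kos M l))

instance instModule (M : Type v) [AddCommGroup M] [Module S M] :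
    ∀ l : List S, Module S (Kos M l)
  | [] => inferInstanceAs (Module S M)
  | _ :: l =>
    letI := instModule M l
    inferInstanceAs (Module S (Kos M l × Kos M l))

variable {M : Type v} [AddCommGroup M] [Module S M]

/-- The element `a + b e_s` of `K(s :: l; M)`. -/
def pair (s : S) {l : List S} (a b : Kos M l) : Kos M (s :: l) := (a, b)

/-- The coefficient `a` of `a + b e_s`. -/
def fst {s : S} {l : List S} (z : Kos M (s :: l)) : Kos M l := z.1

/-- The coefficient `b` of `a + b e_s`. -/
def snd {s : S} {l : List S} (z : Kos M (s :: l)) : Kos M l := z.2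

@[simp] lemma fst_pair (s : S) {l : List S} (a b : Kos M l) : fst (pair s a b) = a := rfl
@[simp] lemma snd_pair (s : S) {l : List S} (a b : Kos M l) : snd (pair s a b) = b := rfl

section simps
variable {s : S} {l : List S} (y z : Kos M (s :: l)) (r : S)
@[simp] lemma fst_add : fst (y + z) = fst y + fst z := rfl
@[simp] lemma snd_add : snd (y + z) = snd y + snd z := rfl
@[simp] lemma fst_neg : fst (-z) = -fst z := rfl
@[simp] lemma snd_neg : snd (-z) = -snd z := rfl
@[simp] lemma fst_smul : fst (r • z) = r • fst z := rfl
@[simp] lemma snd_smul : snd (r • z) = r • snd z := rfl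
@[simp] lemma fst_zero : fst (0 : Kos M (s :: l)) = 0 := rfl
@[simp] lemma snd_zero : snd (0 : Kos M (s :: l)) = 0 := rfl
variable {y z} in
lemma ext_fst_snd (h₁ : fst y = fst z) (h₂ : snd y = snd z) : y = z := Prod.ext h₁ h₂
end simps

/-- The Koszul differential `a + b e_s ↦ (d a + s b) - (d b) e_s`. -/
def d : ∀ l : List S, Kos M l →ₗ[S] Kos M l
  | [] => 0
  | s :: l =>
    { toFun := fun z => pair s (d l (fst z) + s • snd z) (-d l (snd z))
      map_add' := fun y z => ext_fst_snd (by simp; abel) (by simp; abel)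
      map_smul' := fun r z => ext_fst_snd (by simp [smul_comm s r]) (by simp) }

@[simp] lemma d_nil (z : Kos M ([] : List S)) : d [] z = 0 := rfl
@[simp] lemma fst_d {s : S} {l : List S} (z : Kos M (s :: l)) :
    fst (d (s :: l) z) = d l (fst z) + s • snd z := rfl
@[simp] lemma snd_d {s : S} {l : List S} (z : Kos M (s :: l)) :
    snd (d (s :: l) z) = -d l (snd z) := rfl

@[simp] lemma d_d : ∀ (l : List S) (z : Kos M l), d l (d l z) = 0
  | [], _ => rfl
  | _ :: l, z => ext_fst_snd (by simp [d_d l]) (by simp [d_d l])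

/-- The part of the Koszul complex in homological degree `i` with coefficients in `𝓜 q`. -/
def gr (𝓜 : ℤ → AddSubgroup M) : ∀ (l : List S) (_ _ : ℤ), AddSubgroup (Kos M l)
  | [], i, q => if i = 0 then 𝓜 q else (⊥ : AddSubgroup M)
  | _ :: l, i, q => ((gr 𝓜 l i q).prod (gr 𝓜 l (i - 1) q) : AddSubgroup (Kos M l × Kos M l))

variable {𝓜 : ℤ → AddSubgroup M}

lemma mem_gr_nil {i q : ℤ} {z : Kos M ([] : List S)} :
    z ∈ gr 𝓜 [] i q ↔ (i = 0 ∧ (show M from z) ∈ 𝓜 q) ∨ (i ≠ 0 ∧ z = 0) := by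
  by_cases h : i = 0
  · simp only [h, true_and, ne_eq, not_true, false_and, or_false]
    show z ∈ (if (0 : ℤ) = 0 then 𝓜 q else (⊥ : AddSubgroup M)) ↔ _
    rw [if_pos rfl]; exact Iff.rfl
  · simp only [h, false_and, ne_eq, not_false_eq_true, true_and, false_or]
    show z ∈ (if i = 0 then 𝓜 q else (⊥ : AddSubgroup M)) ↔ _
    rw [if_neg h]; exact AddSubgroup.mem_bot

lemma mem_gr_cons {s : S} {l : List S} {i q : ℤ} {z : Kos M (s :: l)} :
    z ∈ gr 𝓜 (s :: l) i q ↔ fst z ∈ gr 𝓜 l i q ∧ snd z ∈ gr 𝓜 l (i - 1) q := Iff.rfl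

lemma eq_zero_of_mem_gr_neg : ∀ (l : List S) {i q : ℤ} {z : Kos M l}, i < 0 →
    z ∈ gr 𝓜 l i q → z = 0
  | [], i, q, z, hi, hz => by
    rcases mem_gr_nil.1 hz with h | h
    · omega
    · exact h.2
  | s :: l, i, q, z, hi, hz => ext_fst_snd (eq_zero_of_mem_gr_neg l hi hz.1)
      (eq_zero_of_mem_gr_neg l (by omega) hz.2)

/-- The elements of the list `l` map `𝓜 q` to `𝓜 (q + 1)`. -/
def RaisesDegree (𝓜 : ℤ → AddSubgroup M) (l : List S) : Prop :=
  ∀ s ∈ l, ∀ q, ∀ m ∈ 𝓜 q, s • m ∈ 𝓜 (q + 1)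

lemma RaisesDegree.tail {s : S} {l : List S} (h : RaisesDegree 𝓜 (s :: l)) :
    RaisesDegree 𝓜 l := fun t ht => h t (List.mem_cons_of_mem _ ht)

lemma smul_mem_gr {s : S} (hs : ∀ q, ∀ m ∈ 𝓜 q, s • m ∈ 𝓜 (q + 1)) :
    ∀ (l : List S) {i q : ℤ} {z : Kos M l}, z ∈ gr 𝓜 l i q → s • z ∈ gr 𝓜 l i (q + 1)
  | [], i, q, z, hz => by
    rcases mem_gr_nil.1 hz with h | h
    · exact mem_gr_nil.2 (Or.inl ⟨h.1, hs q z h.2⟩)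
    · exact mem_gr_nil.2 (Or.inr ⟨h.1, by rw [h.2, smul_zero]⟩)
  | _ :: l, i, q, z, hz => ⟨smul_mem_gr hs l hz.1, smul_mem_gr hs l hz.2⟩

lemma d_mem_gr : ∀ {l : List S}, RaisesDegree 𝓜 l → ∀ {i q : ℤ} {z : Kos M l},
    z ∈ gr 𝓜 l i q → d l z ∈ gr 𝓜 l (i - 1) (q + 1)
  | [], _, i, q, z, _ => by rw [d_nil]; exact zero_mem _
  | s :: l, h, i, q, z, hz => ⟨add_mem (d_mem_gr h.tail hz.1)
      (smul_mem_gr (h s List.mem_cons_self) l hz.2), (gr 𝓜 l _ _).neg_mem (d_mem_gr h.tail hz.2)⟩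

/-- The Koszul homology of `M` with respect to `l` vanishes in homological degree `i` and internal
degree `q + i`. -/
def Vanish (𝓜 : ℤ → AddSubgroup M) (l : List S) (i q : ℤ) : Prop :=
  ∀ z ∈ gr 𝓜 l i q, d l z = 0 → ∃ w ∈ gr 𝓜 l (i + 1) (q - 1), d l w = z

lemma gr_shift (c : ℤ) : ∀ (l : List S) (i q : ℤ),
    gr (fun q => 𝓜 (q + c)) l i q = gr 𝓜 l i (q + c)
  | [], i, q => rfl
  | _ :: l, i, q => by
    ext z
    rw [mem_gr_cons, mem_gr_cons, gr_shift c l, gr_shift c l]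

lemma vanish_shift (c : ℤ) {l : List S} {i q : ℤ} :
    Vanish (fun q => 𝓜 (q + c)) l i q ↔ Vanish 𝓜 l i (q + c) := by
  unfold Vanish
  rw [gr_shift, gr_shift, show q - 1 + c = q + c - 1 by ring]

lemma vanish_of_neg {l : List S} {i q : ℤ} (hi : i < 0) : Vanish 𝓜 l i q := fun z hz _ =>
  ⟨0, zero_mem _, by rw [map_zero, eq_zero_of_mem_gr_neg l hi hz]⟩

/-! ### Functoriality and short exact sequences -/

variable {A B C : Type v} [AddCommGroup A] [Module S A] [AddCommGroup B] [Module S B]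
  [AddCommGroup C] [Module S C]

/-- The map of Koszul complexes induced by a linear map. -/
def map (f : A →ₗ[S] B) : ∀ l : List S, Kos A l →ₗ[S] Kos B l
  | [] => f
  | _ :: l => (map f l).prodMap (map f l)

@[simp] lemma fst_map (f : A →ₗ[S] B) {s : S} {l : List S} (z : Kos A (s :: l)) :
    fst (map f (s :: l) z) = map f l (fst z) := rfl
@[simp] lemma snd_map (f : A →ₗ[S] B) {s : S} {l : List S} (z : Kos A (s :: l)) :
    snd (map f (s :: l) z) = map f l (snd z) := rfl

lemma d_map (f : A →ₗ[S] B) : ∀ (l : List S) (z : Kos A l), d l (map f l z) = map f l (d l z)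
  | [], _ => (map_zero f).symm
  | _ :: l, z => ext_fst_snd (by simp [d_map f l]) (by simp [d_map f l])

/-- `0 → X → Y → Z → 0` is exact, where `X`, `Y`, `Z` are subgroups of the domains and the
codomains of `f` and `g`, and `f` is injective. -/
structure ShortExactOn {A B C : Type*} [AddCommGroup A] [AddCommGroup B] [AddCommGroup C]
    (X : AddSubgroup A) (Y : AddSubgroup B) (Z : AddSubgroup C) (f : A → B) (g : B → C) :
    Prop where
  injective : Function.Injective f
  comp : ∀ a, g (f a) = 0
  map_left : ∀ a ∈ X, f a ∈ Y
  map_right : ∀ b ∈ Y, g b ∈ Z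
  lift : ∀ c ∈ Z, ∃ b ∈ Y, g b = c
  exact : ∀ b ∈ Y, g b = 0 → ∃ a ∈ X, f a = b

variable {𝓐 : ℤ → AddSubgroup A} {𝓑 : ℤ → AddSubgroup B} {𝓒 : ℤ → AddSubgroup C}
  {f : A →ₗ[S] B} {g : B →ₗ[S] C}

lemma ShortExactOn.map (h : ∀ q, ShortExactOn (𝓐 q) (𝓑 q) (𝓒 q) f g) : ∀ (l : List S) (i q : ℤ),
    ShortExactOn (gr 𝓐 l i q) (gr 𝓑 l i q) (gr 𝓒 l i q) (Koszul.map f l) (Koszul.map g l)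
  | [], i, q => by
    by_cases hi : i = 0
    · subst hi; exact h q
    · have e (D : Type v) [AddCommGroup D] [Module S D] (𝓓 : ℤ → AddSubgroup D)
          (z : Kos D ([] : List S)) : z ∈ gr 𝓓 [] i q ↔ z = 0 := by
        rw [mem_gr_nil]; simp [hi]
      refine ⟨(h q).injective, (h q).comp, ?_, ?_, ?_, ?_⟩ <;> simp only [e]
      · rintro a rfl; exact map_zero f
      · rintro a rfl; exact map_zero g
      · rintro a rfl; exact ⟨0, rfl, map_zero g⟩
      · rintro a rfl -; exact ⟨0, rfl, map_zero f⟩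
  | s :: l, i, q => by
    have h₁ := ShortExactOn.map h l i q
    have h₂ := ShortExactOn.map h l (i - 1) q
    refine ⟨h₁.injective.prodMap h₁.injective,
      fun a => ext_fst_snd (h₁.comp _) (h₁.comp _),
      fun a ha => ⟨h₁.map_left _ ha.1, h₂.map_left _ ha.2⟩,
      fun a ha => ⟨h₁.map_right _ ha.1, h₂.map_right _ ha.2⟩, fun c hc => ?_, fun b hb hb0 => ?_⟩
    · obtain ⟨b₁, hb₁, e₁⟩ := h₁.lift _ hc.1
      obtain ⟨b₂, hb₂, e₂⟩ := h₂.lift _ hc.2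
      exact ⟨pair s b₁ b₂, ⟨hb₁, hb₂⟩, ext_fst_snd e₁ e₂⟩
    · obtain ⟨b₁, hb₁, e₁⟩ := h₁.exact _ hb.1 (congrArg fst hb0)
      obtain ⟨b₂, hb₂, e₂⟩ := h₂.exact _ hb.2 (congrArg snd hb0)
      exact ⟨pair s b₁ b₂, ⟨hb₁, hb₂⟩, ext_fst_snd e₁ e₂⟩

variable {l : List S} (h : ∀ q, ShortExactOn (𝓐 q) (𝓑 q) (𝓒 q) f g) {i q : ℤ}
include h

/-- Exactness of Koszul homology at the middle term of a short exact sequence. -/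
lemma vanish_middle (hB : RaisesDegree 𝓑 l) (hA0 : Vanish 𝓐 l i q) (hC0 : Vanish 𝓒 l i q) :
    Vanish 𝓑 l i q := by
  intro z hz dz
  have hs := ShortExactOn.map h l
  obtain ⟨w, hw, ew⟩ := hC0 (map g l z) ((hs i q).map_right z hz)
    (by rw [d_map, dz, map_zero])
  obtain ⟨b, hb, rfl⟩ := (hs _ _).lift w hw
  have hdb : d l b ∈ gr 𝓑 l i q := by simpa using d_mem_gr hB hb
  obtain ⟨a, ha, ea⟩ := (hs i q).exact (z - d l b) (sub_mem hz hdb)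
    (by rw [map_sub, ← d_map, ew, sub_self])
  obtain ⟨a', ha', rfl⟩ := hA0 a ha ((hs i q).injective (by
    rw [← d_map, ea, map_sub, dz, d_d, sub_self, map_zero]))
  exact ⟨b + map f l a', add_mem hb ((hs _ _).map_left _ ha'), by
    rw [map_add, d_map, ea, add_sub_cancel]⟩

/-- Exactness of Koszul homology at the right term of a short exact sequence. -/
lemma vanish_right (hB : RaisesDegree 𝓑 l) (hB0 : Vanish 𝓑 l i q)
    (hA0 : Vanish 𝓐 l (i - 1) (q + 1)) : Vanish 𝓒 l i q := by
  intro z hz dz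
  have hs := ShortExactOn.map h l
  obtain ⟨b, hb, rfl⟩ := (hs _ _).lift z hz
  obtain ⟨a, ha, ea⟩ := (hs _ _).exact (d l b) (d_mem_gr hB hb) (by rw [← d_map, dz])
  obtain ⟨a', ha', rfl⟩ := hA0 a ha ((hs i q).injective (by rw [← d_map, ea, d_d, map_zero]))
  simp only [sub_add_cancel, add_sub_cancel_right] at ha'
  obtain ⟨w, hw, ew⟩ := hB0 (b - map f l a') (sub_mem hb ((hs _ _).map_left _ ha'))
    (by rw [map_sub, d_map, ea, sub_self])
  exact ⟨map g l w, (hs _ _).map_right _ hw, by rw [d_map, ew, map_sub, (hs i q).comp, sub_zero]⟩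

/-- Exactness of Koszul homology at the left term of a short exact sequence. -/
lemma vanish_left (hB : RaisesDegree 𝓑 l)
    (hB0 : ∀ z ∈ gr 𝓐 l i q, d l z = 0 → ∃ w ∈ gr 𝓑 l (i + 1) (q - 1), d l w = map f l z)
    (hC0 : Vanish 𝓒 l (i + 1) (q - 1)) : Vanish 𝓐 l i q := by
  intro z hz dz
  have hs := ShortExactOn.map h l
  -- `hB0` asks only cycles coming from `A` to bound in `B`: for free `B`, vanishing of all homology
  -- can fail in homological degree zero.
  obtain ⟨w, hw, ew⟩ := hB0 z hz dz
  obtain ⟨c, hc, ec⟩ := hC0 _ ((hs _ _).map_right _ hw) (by rw [d_map, ew, (hs i q).comp])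
  obtain ⟨b, hb, rfl⟩ := (hs _ _).lift c hc
  have hdb : d l b ∈ gr 𝓑 l (i + 1) (q - 1) := by simpa using d_mem_gr hB hb
  obtain ⟨a, ha, ea⟩ := (hs _ _).exact (w - d l b) (sub_mem hw hdb)
    (by rw [map_sub, ← d_map, ec, sub_self])
  exact ⟨a, ha, (hs i q).injective (by rw [← d_map, ea, map_sub, d_d, sub_zero, ew])⟩

omit h

/-! ### Low degrees and acyclicity -/

/-- The inclusion of `M` into its Koszul complex. -/
def emb : ∀ l : List S, M → Kos M l
  | [], m => m
  | s :: l, m => pair s (emb l m) 0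

lemma mem_gr_zero : ∀ (l : List S) {q : ℤ} {z : Kos M l},
    z ∈ gr 𝓜 l 0 q ↔ ∃ m ∈ 𝓜 q, z = emb l m
  | [], q, z => by
    rw [mem_gr_nil]; simp only [true_and, ne_eq, not_true, false_and, or_false]
    exact ⟨fun h => ⟨z, h, rfl⟩, by rintro ⟨m, h, rfl⟩; exact h⟩
  | s :: l, q, z => by
    rw [mem_gr_cons, mem_gr_zero l]
    constructor
    · rintro ⟨⟨m, hm, e⟩, h⟩
      exact ⟨m, hm, ext_fst_snd e (eq_zero_of_mem_gr_neg l (by omega) h)⟩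
    · rintro ⟨m, hm, rfl⟩
      exact ⟨⟨m, hm, rfl⟩, zero_mem _⟩

lemma emb_zero : ∀ l : List S, emb l (0 : M) = 0
  | [] => rfl
  | _ :: l => ext_fst_snd (emb_zero l) rfl

lemma emb_add : ∀ (l : List S) (m n : M), emb l (m + n) = emb l m + emb l n
  | [], _, _ => rfl
  | _ :: l, m, n => ext_fst_snd (emb_add l m n) (add_zero _).symm

lemma emb_smul (r : S) : ∀ (l : List S) (m : M), emb l (r • m) = r • emb l m
  | [], _ => rfl
  | _ :: l, m => ext_fst_snd (emb_smul r l m) (smul_zero _).symm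

lemma emb_injective : ∀ l : List S, Function.Injective (emb l : M → Kos M l)
  | [] => fun _ _ h => h
  | _ :: l => fun _ _ h => emb_injective l (congrArg fst h)

lemma map_emb (f : A →ₗ[S] B) : ∀ (l : List S) (a : A), map f l (emb l a) = emb l (f a)
  | [], _ => rfl
  | _ :: l, a => ext_fst_snd (map_emb f l a) (by simp [emb])

lemma d_emb : ∀ (l : List S) (m : M), d l (emb l m) = 0
  | [], _ => rfl
  | _ :: l, m => ext_fst_snd (by simp [emb, d_emb l m]) (by simp [emb])

lemma emb_neg (l : List S) (m : M) : emb l (-m) = -emb l m := by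
  rw [← neg_one_smul S, emb_smul, neg_one_smul]

/-- The boundaries in homological degree zero: the sums of elements `s • m` with `s ∈ l`,
`m ∈ 𝓜 q`. -/
def bd (𝓜 : ℤ → AddSubgroup M) (l : List S) (q : ℤ) : AddSubgroup M :=
  AddSubgroup.closure {m | ∃ s ∈ l, ∃ n ∈ 𝓜 q, m = s • n}

lemma exists_d_eq_emb_smul : ∀ {l : List S} {s : S}, s ∈ l → ∀ {q : ℤ} {m : M}, m ∈ 𝓜 q →
    ∃ w ∈ gr 𝓜 l 1 q, d l w = emb l (s • m)
  | [], s, hs, _, _, _ => by simp at hs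
  | t :: l, s, hs, q, m, hm => by
    rcases List.mem_cons.1 hs with rfl | hs
    · exact ⟨pair s 0 (emb l m), ⟨zero_mem _, (mem_gr_zero l).2 ⟨m, hm, rfl⟩⟩,
        ext_fst_snd (by simp [emb, emb_smul]) (by simp [emb, d_emb])⟩
    · obtain ⟨w, hw, e⟩ := exists_d_eq_emb_smul hs hm
      exact ⟨pair t w 0, ⟨hw, zero_mem _⟩, ext_fst_snd (by simp [emb, e]) (by simp [emb])⟩

/-- In a chain `a + b e_s` of homological degree one, `b` has degree zero, so it is some `n` in `M`;
the summand `s • n` splits off and `a` is handled by recursion. -/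
lemma mem_bd_of_d_eq_emb : ∀ {l : List S} {q : ℤ} {w : Kos M l} {m : M}, w ∈ gr 𝓜 l 1 q →
    d l w = emb l m → m ∈ bd 𝓜 l q
  | [], q, w, m, hw, e => by
    have : m = 0 := e.symm
    rw [this]; exact zero_mem _
  | s :: l, q, w, m, hw, e => by
    obtain ⟨n, hn, en⟩ := (mem_gr_zero l).1 (by simpa using hw.2)
    have e1 : d l (fst w) + s • emb l n = emb l m := by
      rw [← en]; exact congrArg fst e
    have h1 : m - s • n ∈ bd 𝓜 l q := mem_bd_of_d_eq_emb hw.1 (by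
      rw [sub_eq_add_neg, emb_add, emb_neg, emb_smul, ← e1]; abel)
    have h2 : bd 𝓜 l q ≤ bd 𝓜 (s :: l) q := AddSubgroup.closure_mono (by
      rintro _ ⟨t, ht, n, hn, rfl⟩; exact ⟨t, List.mem_cons_of_mem _ ht, n, hn, rfl⟩)
    have h3 : s • n ∈ bd 𝓜 (s :: l) q :=
      AddSubgroup.subset_closure ⟨s, List.mem_cons_self, n, hn, rfl⟩
    simpa using add_mem (h2 h1) h3

lemma exists_d_eq_emb_iff {l : List S} {q : ℤ} {m : M} :
    (∃ w ∈ gr 𝓜 l 1 q, d l w = emb l m) ↔ m ∈ bd 𝓜 l q := by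
  refine ⟨fun ⟨w, hw, e⟩ => mem_bd_of_d_eq_emb hw e, fun h => ?_⟩
  refine AddSubgroup.closure_induction ?_ ?_ ?_ ?_ h
  · rintro _ ⟨s, hs, n, hn, rfl⟩; exact exists_d_eq_emb_smul hs hn
  · exact ⟨0, zero_mem _, by rw [map_zero, emb_zero]⟩
  · rintro a b _ _ ⟨w, hw, e⟩ ⟨w', hw', e'⟩
    exact ⟨w + w', add_mem hw hw', by rw [map_add, emb_add, e, e']⟩
  · rintro a _ ⟨w, hw, e⟩
    exact ⟨-w, neg_mem hw, by rw [map_neg, emb_neg, e]⟩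

/-- Everything in homological degree zero is a cycle, so the homology there is `M / (l) M`. -/
lemma vanish_zero_iff {l : List S} {q : ℤ} : Vanish 𝓜 l 0 q ↔ 𝓜 q ≤ bd 𝓜 l (q - 1) := by
  constructor
  · intro h m hm
    exact exists_d_eq_emb_iff.1 (h _ ((mem_gr_zero l).2 ⟨m, hm, rfl⟩) (d_emb l m))
  · intro h z hz _
    obtain ⟨m, hm, rfl⟩ := (mem_gr_zero l).1 hz
    exact exists_d_eq_emb_iff.2 (h hm)

/-- A list of ring elements that is regular on `M`, in the graded sense. -/
def IsRegularList (𝓜 : ℤ → AddSubgroup M) : List S → Prop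
  | [] => True
  | s :: l => IsRegularList 𝓜 l ∧ ∀ q, ∀ m ∈ 𝓜 q, s • m ∈ bd 𝓜 l q → m ∈ bd 𝓜 l (q - 1)

/-- For a cycle `a + b e_s`, `b` is a cycle and `s b` is a boundary up to sign. Once `b = d c`, the
element `a + s c` is a cycle for the shorter list, hence a boundary. -/
lemma IsRegularList.vanish : ∀ {l : List S}, RaisesDegree 𝓜 l → IsRegularList 𝓜 l →
    ∀ {i : ℤ} (q : ℤ), 0 < i → Vanish 𝓜 l i q
  | [], _, _, i, q, hi => fun z hz _ => by
    rcases mem_gr_nil.1 hz with h | h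
    · omega
    · exact ⟨0, zero_mem _, by rw [h.2, map_zero]⟩
  | s :: l, hr, h, i, q, hi => fun z hz dz => by
    have e1 : d l (fst z) + s • snd z = 0 := congrArg fst dz
    have e2 : d l (snd z) = 0 := neg_eq_zero.1 (congrArg snd dz)
    obtain ⟨c, hc, ec⟩ : ∃ c ∈ gr 𝓜 l i (q - 1), d l c = snd z := by
      -- Regularity of `s` enters only for `i = 1`, where `b` lies in homological degree zero; for
      -- larger `i` the recursion makes `b` a boundary.
      by_cases hi1 : i = 1
      · subst hi1
        obtain ⟨m, hm, em⟩ : ∃ m ∈ 𝓜 q, snd z = emb l m :=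
          (mem_gr_zero l).1 (by simpa using (mem_gr_cons.1 hz).2)
        rw [em]
        refine exists_d_eq_emb_iff.2 (h.2 q m hm (exists_d_eq_emb_iff.1 ⟨-fst z, neg_mem hz.1, ?_⟩))
        rw [emb_smul, ← em, map_neg, eq_comm, ← add_eq_zero_iff_eq_neg, add_comm, e1]
      · simpa using IsRegularList.vanish hr.tail h.1 q (by omega : 0 < i - 1) (snd z) hz.2 e2
    have hsc : s • c ∈ gr 𝓜 l i q := by
      simpa using smul_mem_gr (hr s List.mem_cons_self) l hc
    obtain ⟨e, he, ee⟩ := IsRegularList.vanish hr.tail h.1 q hi (fst z + s • c)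
      (add_mem hz.1 hsc) (by rw [map_add, map_smul, ec, e1])
    exact ⟨pair s e (-c), mem_gr_cons.2 ⟨he, by simpa using hc⟩,
      ext_fst_snd (by simp [ee]) (by simp [ec])⟩

end Koszul

/-! ## Graded free modules over a polynomial ring -/

namespace GradedRes

open MvPolynomial Koszul

variable {k σ : Type*} [Field k]

/-- The homogeneous elements of degree `q` of the free module with basis elements of degrees
`deg a`. -/
noncomputable def freeGr (k σ : Type*) [Field k] {n : ℕ} (deg : Fin n → ℤ) (q : ℤ) :
    AddSubgroup (Fin n → MvPolynomial σ k) where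
  carrier := {f | ∀ a, f a ∈ stdGrading k σ (q - deg a)}
  add_mem' hf hg a := add_mem (hf a) (hg a)
  zero_mem' _ := zero_mem _
  neg_mem' hf a := neg_mem (hf a)

lemma X_mem_stdGrading (v : σ) : (X v : MvPolynomial σ k) ∈ stdGrading k σ 1 :=
  isWeightedHomogeneous_X k _ v

lemma mul_mem_stdGrading {i j : ℤ} {p q : MvPolynomial σ k} (hp : p ∈ stdGrading k σ i)
    (hq : q ∈ stdGrading k σ j) : p * q ∈ stdGrading k σ (i + j) :=
  IsWeightedHomogeneous.mul hp hq

lemma monomial_mem_stdGrading (m : σ →₀ ℕ) (c : k) :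
    monomial m c ∈ stdGrading k σ (Finsupp.weight (fun _ : σ => (1 : ℤ)) m) :=
  isWeightedHomogeneous_monomial _ _ _ rfl

/-- A graded module over a polynomial ring, given by its homogeneous elements `𝓝 q` and the
projections `π q` to its components. -/
structure IsGraded {N : Type*} [AddCommGroup N] [Module (MvPolynomial σ k) N]
    (𝓝 : ℤ → AddSubgroup N) (π : ℤ → N →+ N) : Prop where
  proj_mem : ∀ q n, π q n ∈ 𝓝 q
  proj_same : ∀ q, ∀ n ∈ 𝓝 q, π q n = n
  proj_ne : ∀ q r, ∀ n ∈ 𝓝 q, r ≠ q → π r n = 0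
  smul_mem : ∀ i q, ∀ s ∈ stdGrading k σ i, ∀ n ∈ 𝓝 q, s • n ∈ 𝓝 (i + q)

lemma IsGraded.raisesDegree {N : Type*} [AddCommGroup N] [Module (MvPolynomial σ k) N]
    {𝓝 : ℤ → AddSubgroup N} {π : ℤ → N →+ N} (h : IsGraded (k := k) (σ := σ) 𝓝 π) (L : List σ) :
    RaisesDegree 𝓝 (L.map (X : σ → MvPolynomial σ k)) := by
  intro s hs q m hm
  obtain ⟨v, -, rfl⟩ := List.mem_map.1 hs
  rw [add_comm]
  exact h.smul_mem _ _ _ (X_mem_stdGrading v) _ hm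

/-- The projections of a graded free module to its components. -/
noncomputable def freeProj (k σ : Type*) [Field k] {n : ℕ} (deg : Fin n → ℤ) (q : ℤ) :
    (Fin n → MvPolynomial σ k) →+ (Fin n → MvPolynomial σ k) where
  toFun f a := weightedHomogeneousComponent (fun _ : σ => (1 : ℤ)) (q - deg a) (f a)
  map_zero' := by ext1 a; simp
  map_add' f g := by ext1 a; simp

variable {n : ℕ} {deg : Fin n → ℤ}

lemma isGraded_free : IsGraded (k := k) (σ := σ) (freeGr k σ deg) (freeProj k σ deg) where
  proj_mem q f a := weightedHomogeneousComponent_mem _ _ _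
  proj_same q f hf := funext fun a => (hf a).weightedHomogeneousComponent_same
  proj_ne q r f hf hr := funext fun a => (hf a).weightedHomogeneousComponent_ne _ (by omega)
  smul_mem i q s hs f hf a := by
    have := mul_mem_stdGrading hs (hf a)
    rwa [← add_sub_assoc] at this

lemma single_monomial_mem_freeGr (a : Fin n) (m : σ →₀ ℕ) (c : k) {q : ℤ}
    (h : Finsupp.weight (fun _ : σ => (1 : ℤ)) m = q - deg a) :
    Pi.single a (monomial m c) ∈ freeGr k σ deg q := by
  intro b
  by_cases hb : b = a
  · subst hb; rw [Pi.single_eq_same, ← h]; exact monomial_mem_stdGrading m c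
  · rw [Pi.single_eq_of_ne hb]; exact zero_mem _

/-- The last hypothesis concerns only terms that occur in `f`, so that homogeneity of `f` or
divisibility of its monomials can be used on them. -/
lemma free_induction {P : (Fin n → MvPolynomial σ k) → Prop} (f : Fin n → MvPolynomial σ k)
    (hadd : ∀ f g, P f → P g → P (f + g)) (h0 : P 0)
    (h : ∀ a, ∀ m ∈ (f a).support, P (Pi.single a (monomial m (coeff m (f a))))) : P f := by
  classical
  have hs : ∀ {ι : Type _} (s : Finset ι) (F : ι → Fin n → MvPolynomial σ k),
      (∀ i ∈ s, P (F i)) → P (∑ i ∈ s, F i) := fun s F hF =>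
    Finset.sum_induction F P hadd h0 hF
  rw [← Finset.univ_sum_single f]
  refine hs _ _ fun a _ => ?_
  have e : Pi.single a (f a) = ∑ m ∈ (f a).support,
      (Pi.single a (monomial m (coeff m (f a))) : Fin n → MvPolynomial σ k) := by
    conv_lhs => rw [(f a).as_sum]
    exact map_sum (AddMonoidHom.single (fun _ : Fin n => MvPolynomial σ k) a) _ _
  rw [e]
  exact Finset.sum_induction _ P hadd h0 (h a)

section GradedMap

variable {N : Type*} [AddCommGroup N] [Module (MvPolynomial σ k) N]
  {𝓝 : ℤ → AddSubgroup N} {π : ℤ → N →+ N}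
  {g : (Fin n → MvPolynomial σ k) →ₗ[MvPolynomial σ k] N}

lemma map_single_eq (g : (Fin n → MvPolynomial σ k) →ₗ[MvPolynomial σ k] N) (a : Fin n)
    (p : MvPolynomial σ k) : g (Pi.single a p) = p • g (Pi.single a 1) := by
  rw [← map_smul, ← Pi.single_smul, smul_eq_mul, mul_one]

lemma map_mem_of_graded (hN : IsGraded (k := k) (σ := σ) 𝓝 π)
    (hg : ∀ a, g (Pi.single a 1) ∈ 𝓝 (deg a)) {q : ℤ} {f : Fin n → MvPolynomial σ k}
    (hf : f ∈ freeGr k σ deg q) : g f ∈ 𝓝 q := by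
  rw [← Finset.univ_sum_single f, map_sum]
  refine sum_mem fun a _ => ?_
  rw [map_single_eq]
  have := hN.smul_mem _ _ _ (hf a) _ (hg a)
  rwa [sub_add_cancel] at this

lemma map_freeProj (hN : IsGraded (k := k) (σ := σ) 𝓝 π)
    (hg : ∀ a, g (Pi.single a 1) ∈ 𝓝 (deg a)) (q : ℤ) (f : Fin n → MvPolynomial σ k) :
    g (freeProj k σ deg q f) = π q (g f) := by
  refine free_induction (P := fun f => g (freeProj k σ deg q f) = π q (g f)) f ?_ ?_ ?_
  · intro f f' h h'
    simp only [map_add, h, h']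
  · simp only [map_zero]
  · intro a m _
    have hm := single_monomial_mem_freeGr (deg := deg) a m (coeff m (f a))
      (add_sub_cancel_right _ _).symm
    have hm' := map_mem_of_graded hN hg hm
    by_cases hq : q = Finsupp.weight (fun _ : σ => (1 : ℤ)) m + deg a
    · rw [hq, isGraded_free.proj_same _ _ hm, hN.proj_same _ _ hm']
    · rw [isGraded_free.proj_ne _ _ _ hm hq, hN.proj_ne _ _ _ hm' hq, map_zero]

/-- Resolutions are assumed exact without reference to degrees; projecting a lift to its component
of degree `q` makes them exact degree by degree. -/
lemma exists_homogeneous_lift (hN : IsGraded (k := k) (σ := σ) 𝓝 π)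
    (hg : ∀ a, g (Pi.single a 1) ∈ 𝓝 (deg a)) {q : ℤ} {f : Fin n → MvPolynomial σ k}
    (hf : g f ∈ 𝓝 q) : ∃ f' ∈ freeGr k σ deg q, g f' = g f :=
  ⟨freeProj k σ deg q f, isGraded_free.proj_mem _ _, by
    rw [map_freeProj hN hg, hN.proj_same _ _ hf]⟩

end GradedMap

/-! ### Koszul homology of graded free modules -/

lemma mem_span_of_mem_bd {L : List σ} {q : ℤ} {f : Fin n → MvPolynomial σ k}
    (hf : f ∈ bd (freeGr k σ deg) (L.map (X : σ → MvPolynomial σ k)) q) (a : Fin n) :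
    f a ∈ Ideal.span (X '' {v | v ∈ L} : Set (MvPolynomial σ k)) := by
  refine AddSubgroup.closure_induction (p := fun f _ =>
    f a ∈ Ideal.span (X '' {v | v ∈ L} : Set (MvPolynomial σ k))) ?_ ?_ ?_ ?_ hf
  · rintro _ ⟨s, hs, g, -, rfl⟩
    obtain ⟨v, hv, rfl⟩ := List.mem_map.1 hs
    exact Ideal.mul_mem_right _ _ (Ideal.subset_span ⟨v, hv, rfl⟩)
  · exact zero_mem _
  · intro f g _ _ h h'; exact add_mem h h'
  · intro f _ h; exact neg_mem h

/-- Membership in an ideal of variables is tested on monomials: each term is divisible by some `X v`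
with `v ∈ L`, and the cofactor has degree one less. -/
lemma mem_bd_of_mem_span {L : List σ} {q : ℤ} {f : Fin n → MvPolynomial σ k}
    (hq : f ∈ freeGr k σ deg q)
    (hf : ∀ a, f a ∈ Ideal.span (X '' {v | v ∈ L} : Set (MvPolynomial σ k))) :
    f ∈ bd (freeGr k σ deg) (L.map (X : σ → MvPolynomial σ k)) (q - 1) := by
  refine free_induction f (fun f g h h' => add_mem h h') (zero_mem _) fun a m hm => ?_
  obtain ⟨v, hv, hmv⟩ := mem_ideal_span_X_image.1 (hf a) m hm
  have hw : Finsupp.weight (fun _ : σ => (1 : ℤ)) m = q - deg a := hq a (mem_support_iff.1 hm)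
  have hle : Finsupp.single v 1 ≤ m := by
    rw [Finsupp.single_le_iff]; omega
  have em : m = Finsupp.single v 1 + (m - Finsupp.single v 1) := (add_tsub_cancel_of_le hle).symm
  refine AddSubgroup.subset_closure ⟨X v, List.mem_map.2 ⟨v, hv, rfl⟩,
    Pi.single a (monomial (m - Finsupp.single v 1) (coeff m (f a))),
    single_monomial_mem_freeGr a _ _ ?_, ?_⟩
  · have h2 := congrArg (Finsupp.weight (fun _ : σ => (1 : ℤ))) em
    rw [map_add, Finsupp.weight_single, hw] at h2
    simp only [one_smul] at h2
    omega
  · rw [← Pi.single_smul, smul_eq_mul, X, monomial_mul, one_mul, ← em]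

/-- If `w ∈ L` divides `x_v m`, then `w ≠ v` because the list has no repetition, so `w` already
divides `m`. -/
lemma isRegularList_free : ∀ {L : List σ}, L.Nodup →
    IsRegularList (freeGr k σ deg) (L.map (X : σ → MvPolynomial σ k))
  | [], _ => trivial
  | v :: L, hL => by
    refine ⟨isRegularList_free (List.nodup_cons.1 hL).2, fun q f hf h => ?_⟩
    refine mem_bd_of_mem_span hf fun a => mem_ideal_span_X_image.2 fun m hm => ?_
    have h1 := mem_ideal_span_X_image.1 (mem_span_of_mem_bd h a) (Finsupp.single v 1 + m) (by
      rw [mem_support_iff, Pi.smul_apply, smul_eq_mul, coeff_X_mul]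
      exact mem_support_iff.1 hm)
    obtain ⟨w, hw, hne⟩ := h1
    refine ⟨w, hw, ?_⟩
    have hvw : v ≠ w := by rintro rfl; exact (List.nodup_cons.1 hL).1 hw
    rwa [Finsupp.add_apply, Finsupp.single_eq_of_ne' hvw, zero_add] at hne

lemma vanish_free {L : List σ} (hL : L.Nodup) {i : ℤ} (q : ℤ) (hi : 0 < i) :
    Vanish (freeGr k σ deg) (L.map (X : σ → MvPolynomial σ k)) i q :=
  (isRegularList_free hL).vanish (isGraded_free.raisesDegree L) q hi

universe u v

/-! ### Minimal graded covers and dimension shifting. -/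

section Syzygy

variable {k : Type u} {σ : Type v} [Field k] {n : ℕ} {deg : Fin n → ℤ}
  {N : Type (max u v)} [AddCommGroup N] [Module (MvPolynomial σ k) N] {𝓝 : ℤ → AddSubgroup N}
  {g : (Fin n → MvPolynomial σ k) →ₗ[MvPolynomial σ k] N}

/-- The grading of the kernel of a map from a graded free module. -/
noncomputable def kerGr (deg : Fin n → ℤ)
    (g : (Fin n → MvPolynomial σ k) →ₗ[MvPolynomial σ k] N) (q : ℤ) :
    AddSubgroup (LinearMap.ker g) :=
  (freeGr k σ deg q).comap (LinearMap.ker g).subtype.toAddMonoidHom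

/-- `g` is the first map of a minimal graded free cover. -/
structure IsMinimalCover (deg : Fin n → ℤ) (𝓝 : ℤ → AddSubgroup N)
    (g : (Fin n → MvPolynomial σ k) →ₗ[MvPolynomial σ k] N) : Prop where
  map_mem : ∀ q, ∀ f ∈ freeGr k σ deg q, g f ∈ 𝓝 q
  lift : ∀ q, ∀ m ∈ 𝓝 q, ∃ f ∈ freeGr k σ deg q, g f = m
  minimal : ∀ f, g f = 0 → ∀ a,
    f a ∈ Ideal.span (Set.range (X : σ → MvPolynomial σ k))

lemma IsMinimalCover.shortExactOn (h : IsMinimalCover deg 𝓝 g) (q : ℤ) :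
    ShortExactOn (kerGr deg g q) (freeGr k σ deg q) (𝓝 q) (LinearMap.ker g).subtype g where
  injective := Subtype.val_injective
  comp a := a.2
  map_left _ ha := ha
  map_right := h.map_mem q
  lift := h.lift q
  exact b hb hb0 := ⟨⟨b, hb0⟩, hb, rfl⟩

variable {L : List σ}

lemma span_image_list_eq (hL : ∀ v, v ∈ L) :
    Ideal.span (X '' {v | v ∈ L} : Set (MvPolynomial σ k)) = Ideal.span (Set.range X) := by
  rw [← Set.image_univ, show {v | v ∈ L} = Set.univ from Set.eq_univ_of_forall hL]

/-- Dimension shift along `0 → ker g → F → N → 0`: the free module `F` has no Koszul homology in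
positive homological degrees. -/
lemma IsMinimalCover.vanish_succ_iff (h : IsMinimalCover deg 𝓝 g) (hnd : L.Nodup)
    (hL : ∀ v, v ∈ L) {p q : ℤ} (hp : 0 ≤ p) :
    Vanish 𝓝 (L.map (X : σ → MvPolynomial σ k)) (p + 1) q ↔
      Vanish (kerGr deg g) (L.map (X : σ → MvPolynomial σ k)) p (q + 1) := by
  have hr := (isGraded_free (k := k) (deg := deg)).raisesDegree L
  constructor
  · intro hv
    refine vanish_left h.shortExactOn hr ?_ (by simpa using hv)
    intro z hz dz
    -- For `p = 0` the homology of `F` need not vanish, but minimality puts `ker g` inside `𝔪 F`, so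
    -- its elements are boundaries in `F`.
    rcases hp.eq_or_lt with rfl | hp
    · obtain ⟨m, hm, rfl⟩ := (mem_gr_zero _).1 hz
      rw [map_emb]
      refine exists_d_eq_emb_iff.2 (mem_bd_of_mem_span hm fun a => ?_)
      rw [span_image_list_eq hL]
      exact h.minimal _ m.2 a
    · exact vanish_free hnd (q + 1) hp _ ((ShortExactOn.map h.shortExactOn _ _ _).map_left z hz)
        (by rw [d_map, dz, map_zero])
  · intro hv
    exact vanish_right h.shortExactOn hr (vanish_free hnd q (by omega)) (by simpa using hv)

/-- Since `ker g ⊆ 𝔪 F`, the map `F / 𝔪 F → N / 𝔪 N` is an isomorphism, and the left side has one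
basis element in each degree `deg a`. -/
lemma IsMinimalCover.vanish_zero_iff (h : IsMinimalCover deg 𝓝 g)
    (hL : ∀ v, v ∈ L) {q : ℤ} :
    Vanish 𝓝 (L.map (X : σ → MvPolynomial σ k)) 0 q ↔ ∀ a, deg a ≠ q := by
  rw [Koszul.vanish_zero_iff]
  constructor
  · rintro hv a rfl
    have he : Pi.single a 1 ∈ freeGr k σ deg (deg a) :=
      single_monomial_mem_freeGr a 0 1 (by simp)
    obtain ⟨f, hf, ef⟩ : ∃ f ∈ bd (freeGr k σ deg) (L.map X) (deg a - 1),
        g f = g (Pi.single a 1) := by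
      refine AddSubgroup.closure_induction (p := fun m _ =>
        ∃ f ∈ bd (freeGr k σ deg) (L.map (X : σ → MvPolynomial σ k)) (deg a - 1), g f = m)
        ?_ ?_ ?_ ?_ (hv (h.map_mem _ _ he))
      · rintro _ ⟨s, hs, m, hm, rfl⟩
        obtain ⟨f, hf, rfl⟩ := h.lift _ m hm
        exact ⟨s • f, AddSubgroup.subset_closure ⟨s, hs, f, hf, rfl⟩, map_smul _ _ _⟩
      · exact ⟨0, zero_mem _, map_zero g⟩
      · rintro _ _ _ _ ⟨f, hf, rfl⟩ ⟨f', hf', rfl⟩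
        exact ⟨f + f', add_mem hf hf', map_add g _ _⟩
      · rintro _ _ ⟨f, hf, rfl⟩
        exact ⟨-f, neg_mem hf, map_neg g _⟩
    -- If `g e_a ∈ 𝔪 N`, then `e_a` differs from an element of `𝔪 F` by one of `ker g ⊆ 𝔪 F`, which
    -- puts the constant `1` in `𝔪`.
    have h1 := h.minimal (Pi.single a 1 - f) (by rw [map_sub, ef, sub_self]) a
    have h2 := mem_span_of_mem_bd hf a
    rw [span_image_list_eq hL] at h2
    have h3 := add_mem h1 h2
    rw [Pi.sub_apply, sub_add_cancel, Pi.single_eq_same, ← Set.image_univ] at h3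
    obtain ⟨i, -, hi⟩ := mem_ideal_span_X_image.1 h3 0 (by simp)
    exact hi rfl
  · intro hd m hm
    obtain ⟨f, hf, rfl⟩ := h.lift _ m hm
    have hb : f ∈ bd (freeGr k σ deg) (L.map (X : σ → MvPolynomial σ k)) (q - 1) := by
      refine mem_bd_of_mem_span hf fun a => mem_ideal_span_X_image.2 fun m hm => ?_
      have hw : Finsupp.weight (fun _ : σ => (1 : ℤ)) m = q - deg a := hf a (mem_support_iff.1 hm)
      -- A constant term in the entry `a` would force `deg a = q`.
      by_contra! hc
      have : m = 0 := Finsupp.ext fun v => hc v (hL v)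
      rw [this, map_zero] at hw
      exact hd a (by omega)
    refine AddSubgroup.closure_induction (p := fun f _ => g f ∈ bd 𝓝
      (L.map (X : σ → MvPolynomial σ k)) (q - 1)) ?_ ?_ ?_ ?_ hb
    · rintro _ ⟨s, hs, f, hf, rfl⟩
      rw [map_smul]
      exact AddSubgroup.subset_closure ⟨s, hs, g f, h.map_mem _ _ hf, rfl⟩
    · rw [map_zero]; exact zero_mem _
    · intro f f' _ _ h h'; rw [map_add]; exact add_mem h h'
    · intro f _ h; rw [map_neg]; exact neg_mem h

end Syzygy

/-! ### Betti numbers and Koszul homology -/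

section Betti

variable {k : Type u} {σ : Type v} [Field k] {N : Type (max u v)} [AddCommGroup N] [Module k N]
  [Module (MvPolynomial σ k) N] {𝓝 : ℤ → Submodule k N} {π : ℤ → N →+ N} {L : List σ}

namespace MinimalGradedFreeResolution

lemma betti_ne_zero_iff (F : MinimalGradedFreeResolution k σ 𝓝) (i : ℕ) (j : ℤ) :
    F.betti i j ≠ 0 ↔ ∃ a, F.deg i a = j := by
  simp [betti, Finset.filter_eq_empty_iff]

variable (F : MinimalGradedFreeResolution k σ 𝓝)

lemma apply_mem_span {n m : ℕ}
    {f : (Fin n → MvPolynomial σ k) →ₗ[MvPolynomial σ k] (Fin m → MvPolynomial σ k)}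
    {J : Ideal (MvPolynomial σ k)} (h : ∀ a b, f (Pi.single a 1) b ∈ J)
    (x : Fin n → MvPolynomial σ k) (b : Fin m) : f x b ∈ J := by
  rw [← Finset.univ_sum_single x, map_sum, Finset.sum_apply]
  refine sum_mem fun a _ => ?_
  rw [map_single_eq]
  exact Ideal.mul_mem_left _ _ (h a b)

lemma isMinimalCover_aug (hN : IsGraded (k := k) (σ := σ) (fun q => (𝓝 q).toAddSubgroup) π) :
    IsMinimalCover (F.deg 0) (fun q => (𝓝 q).toAddSubgroup) F.aug where
  map_mem q f hf := map_mem_of_graded hN F.aug_graded hf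
  lift q m hm := by
    obtain ⟨f, rfl⟩ := F.aug_surjective m
    exact exists_homogeneous_lift hN F.aug_graded hm
  minimal f hf a := by
    obtain ⟨x, rfl⟩ := (F.exact_aug f).1 hf
    exact apply_mem_span (F.minimal 0) x a

-- Stated for any `g` following `F.d i`, so that one statement serves both the augmentation and the
-- differentials.
variable {F} in
lemma isMinimalCover_codRestrict {i : ℕ} {M : Type (max u v)} [AddCommGroup M]
    [Module (MvPolynomial σ k) M] {g : (Fin (F.rank i) → MvPolynomial σ k) →ₗ[MvPolynomial σ k] M}
    (hg : Function.Exact (F.d i) g) :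
    IsMinimalCover (F.deg (i + 1)) (kerGr (F.deg i) g)
      ((F.d i).codRestrict (LinearMap.ker g) hg.apply_apply_eq_zero) where
  map_mem q f hf := map_mem_of_graded isGraded_free (F.d_graded i) hf
  lift q m hm := by
    obtain ⟨f, hf⟩ := (hg m).1 m.2
    obtain ⟨f', hf', e⟩ := exists_homogeneous_lift isGraded_free (F.d_graded i) (f := f)
      (by rw [hf]; exact hm)
    exact ⟨f', hf', Subtype.ext (e.trans hf)⟩
  minimal f hf a := by
    obtain ⟨x, rfl⟩ := (F.exact_d i f).1 (congrArg Subtype.val hf)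
    exact apply_mem_span (F.minimal (i + 1)) x a

variable (hnd : L.Nodup) (hL : ∀ v, v ∈ L)
include hnd hL

/-- Induction on `p`: passing to the kernel of the cover lowers `p` by one and raises `i` and `q` by
one, so `i + p` and `q + p` are unchanged. The module and the cover must stay general. -/
lemma vanish_iff_of_isMinimalCover (p : ℕ) : ∀ {i : ℕ} {M : Type (max u v)} [AddCommGroup M]
    [Module (MvPolynomial σ k) M] {𝓜 : ℤ → AddSubgroup M}
    {g : (Fin (F.rank i) → MvPolynomial σ k) →ₗ[MvPolynomial σ k] M},
    Function.Exact (F.d i) g → IsMinimalCover (F.deg i) 𝓜 g → ∀ q : ℤ,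
    (Vanish 𝓜 (L.map (X : σ → MvPolynomial σ k)) p q ↔ F.betti (i + p) (q + p) = 0) := by
  induction p with
  | zero =>
    intro i M _ _ 𝓜 g _ hc q
    rw [Nat.cast_zero, hc.vanish_zero_iff hL, add_zero, add_zero, ← not_iff_not,
      ← ne_eq (F.betti i q), betti_ne_zero_iff]
    simp
  | succ p ih =>
    intro i M _ _ 𝓜 g hg hc q
    rw [Nat.cast_succ, hc.vanish_succ_iff hnd hL (by positivity),
      ih (fun y => ?_) (isMinimalCover_codRestrict hg) (q + 1),
      show i + 1 + p = i + (p + 1) by omega, show q + 1 + (p : ℤ) = q + (p + 1) by ring]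
    rw [← F.exact_d i y, Subtype.ext_iff]; rfl

/-- Graded Betti numbers are detected by Koszul homology. -/
theorem vanish_iff_betti_eq_zero
    (hN : IsGraded (k := k) (σ := σ) (fun q => (𝓝 q).toAddSubgroup) π) (p : ℕ) (q : ℤ) :
    Vanish (fun q => (𝓝 q).toAddSubgroup) (L.map (X : σ → MvPolynomial σ k)) p q ↔
      F.betti p (q + p) = 0 := by
  rw [vanish_iff_of_isMinimalCover F hnd hL p F.exact_aug (F.isMinimalCover_aug hN) q, zero_add]

end MinimalGradedFreeResolution
end Betti

end GradedRes

/-! ## Graded quotients of polynomial rings and their resolutions -/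

namespace GradedRes

open MvPolynomial Koszul

variable {k σ : Type*} [Field k]

/-- An ideal that contains the homogeneous components of its elements. -/
def IsHomogeneousIdeal (I : Ideal (MvPolynomial σ k)) : Prop :=
  ∀ p ∈ I, ∀ q, weightedHomogeneousComponent (fun _ : σ => (1 : ℤ)) q p ∈ I

lemma weight_eq_zero_iff {m : σ →₀ ℕ} : Finsupp.weight (fun _ : σ => (1 : ℤ)) m = 0 ↔ m = 0 := by
  refine ⟨fun h => ?_, fun h => by rw [h, map_zero]⟩
  rw [Finsupp.weight_apply, Finsupp.sum,
    Finset.sum_eq_zero_iff_of_nonneg (fun i _ => by positivity)] at h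
  ext i
  by_contra hi
  have := h i (Finsupp.mem_support_iff.2 hi)
  simp only [mul_one, nsmul_eq_mul, Nat.cast_eq_zero] at this
  exact hi this

/-- The projections of `S / I` to its homogeneous components. -/
noncomputable def quotientProj {I : Ideal (MvPolynomial σ k)} (hI : IsHomogeneousIdeal I) (q : ℤ) :
    MvPolynomial σ k ⧸ I →+ MvPolynomial σ k ⧸ I :=
  (QuotientAddGroup.map I.toAddSubgroup I.toAddSubgroup
    (weightedHomogeneousComponent (fun _ : σ => (1 : ℤ)) q).toAddMonoidHom fun p hp => hI p hp q)

lemma quotientProj_mk {I : Ideal (MvPolynomial σ k)} (hI : IsHomogeneousIdeal I) (q : ℤ)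
    (p : MvPolynomial σ k) : quotientProj hI q (Ideal.Quotient.mk I p) =
      Ideal.Quotient.mk I (weightedHomogeneousComponent (fun _ : σ => (1 : ℤ)) q p) := rfl

lemma mem_quotientGrading {I : Ideal (MvPolynomial σ k)} {q : ℤ} {x : MvPolynomial σ k ⧸ I} :
    x ∈ quotientGrading I q ↔ ∃ p ∈ stdGrading k σ q, Ideal.Quotient.mk I p = x := Iff.rfl

lemma isGraded_quotient {I : Ideal (MvPolynomial σ k)} (hI : IsHomogeneousIdeal I) :
    IsGraded (k := k) (σ := σ) (fun q => (quotientGrading I q).toAddSubgroup)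
      (quotientProj hI) where
  proj_mem q x := by
    obtain ⟨p, rfl⟩ := Ideal.Quotient.mk_surjective x
    exact mem_quotientGrading.2 ⟨_, weightedHomogeneousComponent_mem _ p q, rfl⟩
  proj_same q x hx := by
    obtain ⟨p, hp, rfl⟩ := mem_quotientGrading.1 hx
    rw [quotientProj_mk, IsWeightedHomogeneous.weightedHomogeneousComponent_same hp]
  proj_ne q r x hx hr := by
    obtain ⟨p, hp, rfl⟩ := mem_quotientGrading.1 hx
    have h0 := IsWeightedHomogeneous.weightedHomogeneousComponent_ne r hp (by exact hr)
    rw [quotientProj_mk, h0, map_zero]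
  smul_mem i q s hs x hx := by
    obtain ⟨p, hp, rfl⟩ := mem_quotientGrading.1 hx
    exact mem_quotientGrading.2 ⟨s * p, mul_mem_stdGrading hs hp, rfl⟩

/-! ### Minimal homogeneous generators -/

variable {n : ℕ} {deg : Fin n → ℤ}

lemma exists_sum_freeProj_eq (deg : Fin n → ℤ) (f : Fin n → MvPolynomial σ k) :
    ∃ Q : Finset ℤ, ∀ Q' : Finset ℤ, Q ⊆ Q' → ∑ q ∈ Q', freeProj k σ deg q f = f := by
  classical
  refine free_induction (P := fun f => ∃ Q : Finset ℤ, ∀ Q' : Finset ℤ, Q ⊆ Q' →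
    ∑ q ∈ Q', freeProj k σ deg q f = f) f ?_ ?_ ?_
  · rintro f g ⟨Q, hQ⟩ ⟨R, hR⟩
    refine ⟨Q ∪ R, fun Q' h => ?_⟩
    simp only [map_add, Finset.sum_add_distrib]
    rw [hQ Q' (Finset.union_subset_left h), hR Q' (Finset.union_subset_right h)]
  · exact ⟨∅, fun Q' _ => by simp⟩
  · intro a m _
    have hm := single_monomial_mem_freeGr (deg := deg) a m (coeff m (f a))
      (add_sub_cancel_right _ _).symm
    refine ⟨{Finsupp.weight (fun _ : σ => (1 : ℤ)) m + deg a}, fun Q' h => ?_⟩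
    rw [Finset.sum_eq_single_of_mem _ (Finset.singleton_subset_iff.1 h)
      fun q _ hq => isGraded_free.proj_ne _ _ _ hm hq, isGraded_free.proj_same _ _ hm]

/-- A family of homogeneous generators of a submodule of a graded free module. -/
def HasHomogeneousGenerators (deg : Fin n → ℤ)
    (Z : Submodule (MvPolynomial σ k) (Fin n → MvPolynomial σ k)) (m : ℕ) : Prop :=
  ∃ (deg' : Fin m → ℤ) (γ : Fin m → Fin n → MvPolynomial σ k),
    (∀ a, γ a ∈ freeGr k σ deg (deg' a)) ∧ Submodule.span _ (Set.range γ) = Z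

lemma exists_hasHomogeneousGenerators [Finite σ]
    {Z : Submodule (MvPolynomial σ k) (Fin n → MvPolynomial σ k)}
    (hZ : ∀ f ∈ Z, ∀ q, freeProj k σ deg q f ∈ Z) : ∃ m, HasHomogeneousGenerators deg Z m := by
  have hspan : Submodule.span (MvPolynomial σ k) {f | f ∈ Z ∧ ∃ q, f ∈ freeGr k σ deg q} = Z := by
    refine le_antisymm (Submodule.span_le.2 fun f hf => hf.1) fun f hf => ?_
    obtain ⟨Q, hQ⟩ := exists_sum_freeProj_eq deg f
    rw [← hQ Q subset_rfl]
    exact sum_mem fun q _ =>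
      Submodule.subset_span ⟨hZ f hf q, q, isGraded_free.proj_mem _ _⟩
  have hfg := IsNoetherian.noetherian Z
  rw [← hspan, Submodule.fg_span_iff_fg_span_finset_subset] at hfg
  obtain ⟨s, hs, e⟩ := hfg
  choose q hq using fun a : Fin s.card => (hs (s.equivFin.symm a).2).2
  refine ⟨s.card, q, fun a => (s.equivFin.symm a).1, hq, ?_⟩
  have hr : Set.range (fun a => (s.equivFin.symm a).1) = s :=
    (s.equivFin.symm.surjective.range_comp Subtype.val).trans Subtype.range_coe
  rw [← hspan, e, hr]

/-- A generator whose coefficient in a relation is a unit is a combination of the others. -/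
lemma HasHomogeneousGenerators.drop {m : ℕ} {Z : Submodule (MvPolynomial σ k)
    (Fin n → MvPolynomial σ k)} {deg' : Fin (m + 1) → ℤ}
    {γ : Fin (m + 1) → Fin n → MvPolynomial σ k} (hγ : ∀ a, γ a ∈ freeGr k σ deg (deg' a))
    (hZ : Submodule.span _ (Set.range γ) = Z) {a : Fin (m + 1)}
    {f : Fin (m + 1) → MvPolynomial σ k} (hf : ∑ b, f b • γ b = 0) {c : k} (hc : c ≠ 0)
    (hfa : f a = C c) : HasHomogeneousGenerators deg Z m := by
  refine ⟨deg' ∘ a.succAbove, γ ∘ a.succAbove, fun b => hγ _, ?_⟩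
  refine le_antisymm ?_ ?_
  · rw [← hZ]; exact Submodule.span_mono (Set.range_comp_subset_range _ _)
  · rw [← hZ, Submodule.span_le]
    rintro _ ⟨b, rfl⟩
    have hmem : ∀ b, γ (a.succAbove b) ∈
        Submodule.span (MvPolynomial σ k) (Set.range (γ ∘ a.succAbove)) :=
      fun b => Submodule.subset_span ⟨b, rfl⟩
    rcases Fin.eq_self_or_eq_succAbove a b with rfl | ⟨b, rfl⟩
    · rw [Fin.sum_univ_succAbove _ b, hfa, add_eq_zero_iff_eq_neg] at hf
      have : γ b = (C c⁻¹ : MvPolynomial σ k) • ((C c : MvPolynomial σ k) • γ b) := by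
        rw [smul_smul, ← C_mul, inv_mul_cancel₀ hc, C_1, one_smul]
      rw [SetLike.mem_coe, this, hf]
      exact Submodule.smul_mem _ _ (neg_mem (sum_mem fun b _ => Submodule.smul_mem _ _ (hmem b)))
    · exact hmem b

/-- A homogeneous submodule of a graded free module is the image of a minimal graded map. -/
lemma exists_minimal_graded_map [Finite σ]
    {Z : Submodule (MvPolynomial σ k) (Fin n → MvPolynomial σ k)}
    (hZ : ∀ f ∈ Z, ∀ q, freeProj k σ deg q f ∈ Z) :
    ∃ (m : ℕ) (deg' : Fin m → ℤ)
      (g : (Fin m → MvPolynomial σ k) →ₗ[MvPolynomial σ k] (Fin n → MvPolynomial σ k)),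
      (∀ a, g (Pi.single a 1) ∈ freeGr k σ deg (deg' a)) ∧ LinearMap.range g = Z ∧
      ∀ f ∈ LinearMap.ker g, ∀ a, f a ∈ Ideal.span (Set.range (X : σ → MvPolynomial σ k)) := by
  classical
  have hex := exists_hasHomogeneousGenerators hZ
  obtain ⟨deg', γ, hγ, e⟩ := Nat.find_spec hex
  set g := Fintype.linearCombination (MvPolynomial σ k) γ with hg
  have hg1 : ∀ a, g (Pi.single a 1) ∈ freeGr k σ deg (deg' a) := fun a => by
    rw [hg, Fintype.linearCombination_apply_single, one_smul]; exact hγ a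
  refine ⟨_, deg', g, hg1, by rw [hg, Fintype.range_linearCombination, e], fun f hf a => ?_⟩
  -- The number of generators is least possible; a relation with an entry outside `𝔪` would make one
  -- of them redundant.
  by_contra hfa
  rw [← Set.image_univ, mem_ideal_span_X_image] at hfa
  push Not at hfa
  obtain ⟨m, hm, hm0⟩ := hfa
  obtain rfl : m = 0 := Finsupp.ext fun v => hm0 v trivial
  -- In the component of degree `deg' a` of the relation, the entry `a` has degree zero: it is
  -- exactly the non-zero constant term of `f a`.
  have h0 := map_freeProj isGraded_free hg1 (deg' a) f
  rw [LinearMap.mem_ker.1 hf, map_zero, hg, Fintype.linearCombination_apply] at h0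
  have ha : freeProj k σ deg' (deg' a) f a = C (coeff 0 (f a)) := by
    ext d
    simp only [freeProj, AddMonoidHom.coe_mk, ZeroHom.coe_mk, sub_self,
      coeff_weightedHomogeneousComponent, coeff_C, weight_eq_zero_iff, @eq_comm _ 0 d]
    split_ifs with h
    · rw [h]
    · rfl
  have hpos : 0 < Nat.find hex := Fin.pos a
  obtain ⟨m, hm'⟩ : ∃ m, Nat.find hex = m + 1 := ⟨Nat.find hex - 1, by omega⟩
  -- The number of generators is replaced by a variable `N`, so that `N = m + 1` can be substituted
  -- in the types.
  have key : ∀ {N : ℕ} (_ : N = m + 1) (deg' : Fin N → ℤ) (γ : Fin N → Fin n → MvPolynomial σ k)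
      (_ : ∀ a, γ a ∈ freeGr k σ deg (deg' a)) (_ : Submodule.span _ (Set.range γ) = Z) (a : Fin N)
      (f : Fin N → MvPolynomial σ k) (_ : ∑ b, f b • γ b = 0) (c : k) (_ : c ≠ 0)
      (_ : f a = C c), HasHomogeneousGenerators deg Z m := by
    rintro N rfl deg' γ hγ e a f hf c hc hfa
    exact HasHomogeneousGenerators.drop hγ e hf hc hfa
  have := key hm' deg' γ hγ e a _ h0 _ (mem_support_iff.1 hm) ha
  exact Nat.find_min hex (by omega) this

/-! ### Existence of minimal resolutions -/

/-- A homogeneous submodule `Z` of a graded free module `F` with `Z ⊆ 𝔪 F`. -/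
structure SyzygyModule (k σ : Type*) [Field k] where
  n : ℕ
  deg : Fin n → ℤ
  Z : Submodule (MvPolynomial σ k) (Fin n → MvPolynomial σ k)
  homogeneous : ∀ f ∈ Z, ∀ q, freeProj k σ deg q f ∈ Z
  minimal : ∀ f ∈ Z, ∀ a, f a ∈ Ideal.span (Set.range (X : σ → MvPolynomial σ k))

namespace SyzygyModule

lemma exists_next [Finite σ] (A : SyzygyModule k σ) : ∃ (B : SyzygyModule k σ)
    (g : (Fin B.n → MvPolynomial σ k) →ₗ[MvPolynomial σ k] (Fin A.n → MvPolynomial σ k)),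
    (∀ a, g (Pi.single a 1) ∈ freeGr k σ A.deg (B.deg a)) ∧ LinearMap.range g = A.Z ∧
      LinearMap.ker g = B.Z := by
  obtain ⟨m, deg', g, h1, h2, h3⟩ := exists_minimal_graded_map A.homogeneous
  exact ⟨⟨m, deg', LinearMap.ker g, fun f hf q => by
    rw [LinearMap.mem_ker] at hf ⊢
    rw [map_freeProj isGraded_free h1, hf, map_zero], h3⟩, g, h1, h2, rfl⟩

variable [Finite σ] (A : SyzygyModule k σ)

/-- The iterated syzygy modules. -/
noncomputable def syz : ℕ → SyzygyModule k σ
  | 0 => A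
  | i + 1 => (exists_next (syz i)).choose

/-- The maps between the minimal covers of the iterated syzygy modules. -/
noncomputable def diff (i : ℕ) : (Fin (A.syz (i + 1)).n → MvPolynomial σ k) →ₗ[MvPolynomial σ k]
    (Fin (A.syz i).n → MvPolynomial σ k) :=
  (exists_next (A.syz i)).choose_spec.choose

lemma diff_spec (i : ℕ) :
    (∀ a, A.diff i (Pi.single a 1) ∈ freeGr k σ (A.syz i).deg ((A.syz (i + 1)).deg a)) ∧
      LinearMap.range (A.diff i) = (A.syz i).Z ∧ LinearMap.ker (A.diff i) = (A.syz (i + 1)).Z :=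
  (exists_next (A.syz i)).choose_spec.choose_spec

end SyzygyModule

/-- Quotients by proper homogeneous ideals have minimal graded free resolutions. -/
theorem nonempty_minimalGradedFreeResolution [Finite σ] {I : Ideal (MvPolynomial σ k)}
    (hI : IsHomogeneousIdeal I) (hm : I ≤ Ideal.span (Set.range X)) :
    Nonempty (MinimalGradedFreeResolution k σ (quotientGrading I)) := by
  let aug : (Fin 1 → MvPolynomial σ k) →ₗ[MvPolynomial σ k] MvPolynomial σ k ⧸ I :=
    I.mkQ ∘ₗ LinearMap.proj 0
  have haug : ∀ f, aug f = 0 ↔ f 0 ∈ I := fun f => Ideal.Quotient.eq_zero_iff_mem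
  have haug' : ∀ a, aug (Pi.single a 1) ∈ quotientGrading I 0 := fun a =>
    mem_quotientGrading.2 ⟨1, isWeightedHomogeneous_one k _, by
      rw [Subsingleton.elim a 0]
      show _ = Ideal.Quotient.mk I ((Pi.single 0 1 : Fin 1 → MvPolynomial σ k) 0)
      rw [Pi.single_eq_same]⟩
  -- The syzygies start from `I` inside `S` with its generator in degree zero; `hm` is the
  -- minimality of the augmentation.
  let A : SyzygyModule k σ :=
    { n := 1
      deg := 0
      Z := LinearMap.ker aug
      homogeneous := fun f hf q => by
        rw [LinearMap.mem_ker, haug] at hf ⊢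
        exact hI _ hf _
      minimal := fun f hf a => by
        rw [LinearMap.mem_ker, haug] at hf
        rw [Subsingleton.elim a 0]
        exact hm hf }
  exact ⟨{
    rank := fun i => (A.syz i).n
    deg := fun i => (A.syz i).deg
    d := A.diff
    aug := aug
    aug_surjective := fun x => by
      obtain ⟨p, rfl⟩ := Ideal.Quotient.mk_surjective x
      exact ⟨fun _ => p, rfl⟩
    exact_aug := LinearMap.exact_iff.2 (A.diff_spec 0).2.1.symm
    exact_d := fun i => LinearMap.exact_iff.2
      ((A.diff_spec i).2.2.trans (A.diff_spec (i + 1)).2.1.symm)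
    aug_graded := fun a => haug' a
    d_graded := fun i a b => (A.diff_spec i).1 a b
    minimal := fun i a b => (A.syz i).minimal _ (by
      rw [← (A.diff_spec i).2.1]; exact ⟨_, rfl⟩) b }⟩

end GradedRes

/-! ## Monomial ideals and edge ideals -/

namespace GradedRes

open MvPolynomial Koszul

section MonomialIdeal

variable {k σ : Type*} [Field k]

/-- The monomial ideal generated by the monomials with exponents in `E`. -/
noncomputable def monIdeal (k : Type*) [Field k] (E : Set (σ →₀ ℕ)) : Ideal (MvPolynomial σ k) :=
  Ideal.span ((fun s => monomial s (1 : k)) '' E)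

/-- The exponents of the monomials in the ideal generated by the monomials with exponents in
`E`. -/
def upSet (E : Set (σ →₀ ℕ)) : Set (σ →₀ ℕ) := {m | ∃ s ∈ E, s ≤ m}

lemma mem_monIdeal {E : Set (σ →₀ ℕ)} {p : MvPolynomial σ k} :
    p ∈ monIdeal k E ↔ ∀ m ∈ p.support, m ∈ upSet E := mem_ideal_span_monomial_image

lemma isHomogeneousIdeal_monIdeal (E : Set (σ →₀ ℕ)) : IsHomogeneousIdeal (monIdeal k E) := by
  classical
  intro p hp q
  rw [mem_monIdeal] at hp ⊢
  intro m hm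
  rw [support_weightedHomogeneousComponent] at hm
  exact hp m (Finset.mem_filter.1 hm).1

variable {E E' E'' : Set (σ →₀ ℕ)} {x : σ}

/-- Multiplication by `x` as a map `S / (I : x) → S / I`. -/
noncomputable def mulX (h : ∀ m, Finsupp.single x 1 + m ∈ upSet E ↔ m ∈ upSet E') :
    (MvPolynomial σ k ⧸ monIdeal k E') →ₗ[MvPolynomial σ k] (MvPolynomial σ k ⧸ monIdeal k E) :=
  Submodule.mapQ _ _ (LinearMap.mulLeft (MvPolynomial σ k) (X x)) (Submodule.span_le.2 (by
    rintro _ ⟨s, hs, rfl⟩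
    refine mem_monIdeal.2 fun m hm => ?_
    rw [LinearMap.mulLeft_apply, X, monomial_mul] at hm
    rw [Finset.mem_singleton.1 (support_monomial_subset hm), h]
    exact ⟨s, hs, le_rfl⟩))

lemma mulX_mk (h : ∀ m, Finsupp.single x 1 + m ∈ upSet E ↔ m ∈ upSet E') (p : MvPolynomial σ k) :
    mulX h (Ideal.Quotient.mk _ p) = Ideal.Quotient.mk _ (X x * p) := rfl

/-- The projection `S / I → S / J` for `I ⊆ J`. -/
noncomputable def quotMap {I J : Ideal (MvPolynomial σ k)} (h : I ≤ J) :
    (MvPolynomial σ k ⧸ I) →ₗ[MvPolynomial σ k] (MvPolynomial σ k ⧸ J) :=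
  Submodule.mapQ _ _ LinearMap.id h

lemma quotMap_mk {I J : Ideal (MvPolynomial σ k)} (h : I ≤ J) (p : MvPolynomial σ k) :
    quotMap h (Ideal.Quotient.mk _ p) = Ideal.Quotient.mk _ p := rfl

lemma monIdeal_le (h : ∀ m, m ∈ upSet E'' ↔ m ∈ upSet E ∨ m x ≠ 0) :
    monIdeal k E ≤ monIdeal k E'' := fun p hp => by
  rw [mem_monIdeal] at hp ⊢
  exact fun m hm => (h m).2 (Or.inl (hp m hm))

/-- The exact sequence `0 → S / (I : x) (-1) → S / I → S / (I, x) → 0` for a monomial ideal `I`. -/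
lemma shortExactOn_monIdeal (h₁ : ∀ m, Finsupp.single x 1 + m ∈ upSet E ↔ m ∈ upSet E')
    (h₂ : ∀ m, m ∈ upSet E'' ↔ m ∈ upSet E ∨ m x ≠ 0) (q : ℤ) :
    ShortExactOn (quotientGrading (monIdeal k E') (q + -1)).toAddSubgroup
      (quotientGrading (monIdeal k E) q).toAddSubgroup
      (quotientGrading (monIdeal k E'') q).toAddSubgroup (mulX h₁)
      (quotMap (monIdeal_le h₂)) where
  injective := by
    rw [injective_iff_map_eq_zero]
    intro a ha
    obtain ⟨p, rfl⟩ := Ideal.Quotient.mk_surjective a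
    rw [mulX_mk, Ideal.Quotient.eq_zero_iff_mem, mem_monIdeal] at ha
    rw [Ideal.Quotient.eq_zero_iff_mem, mem_monIdeal]
    intro m hm
    rw [← h₁]
    refine ha _ ?_
    rw [mem_support_iff, coeff_X_mul]
    exact mem_support_iff.1 hm
  comp a := by
    obtain ⟨p, rfl⟩ := Ideal.Quotient.mk_surjective a
    rw [mulX_mk, quotMap_mk, Ideal.Quotient.eq_zero_iff_mem]
    refine Ideal.mul_mem_right _ _ (mem_monIdeal.2 fun m hm => (h₂ m).2 (Or.inr ?_))
    rw [support_X, Finset.mem_singleton] at hm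
    rw [hm, Finsupp.single_eq_same]; exact one_ne_zero
  map_left a ha := by
    obtain ⟨p, hp, rfl⟩ := mem_quotientGrading.1 ha
    refine mem_quotientGrading.2 ⟨X x * p, ?_, rfl⟩
    have := mul_mem_stdGrading (X_mem_stdGrading x) hp
    rwa [show 1 + (q + -1) = q by ring] at this
  map_right b hb := by
    obtain ⟨p, hp, rfl⟩ := mem_quotientGrading.1 hb
    exact mem_quotientGrading.2 ⟨p, hp, rfl⟩
  lift c hc := by
    obtain ⟨p, hp, rfl⟩ := mem_quotientGrading.1 hc
    exact ⟨_, mem_quotientGrading.2 ⟨p, hp, rfl⟩, rfl⟩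
  exact b hb hb0 := by
    obtain ⟨p, hp, rfl⟩ := mem_quotientGrading.1 hb
    rw [quotMap_mk, Ideal.Quotient.eq_zero_iff_mem, mem_monIdeal] at hb0
    -- The preimage is the quotient of `p` by `x`. The remainder consists of terms of `p` not
    -- divisible by `x`; these lie in `(I, x)`, hence in `I`.
    refine ⟨_, mem_quotientGrading.2 ⟨p.divMonomial (Finsupp.single x 1), fun m hm => ?_, rfl⟩, ?_⟩
    · rw [coeff_divMonomial] at hm
      have := hp hm
      rw [map_add, Finsupp.weight_single, one_smul] at this
      omega
    · rw [mulX_mk, eq_comm, Ideal.Quotient.eq, mem_monIdeal]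
      intro m hm
      have e : p - X x * (p.divMonomial (Finsupp.single x 1)) = p.modMonomial (Finsupp.single x 1) := by
        rw [sub_eq_iff_eq_add, add_comm, divMonomial_add_modMonomial_single]
      rw [e, mem_support_iff] at hm
      have hmx : ¬ Finsupp.single x 1 ≤ m := fun hle => hm (coeff_modMonomial_of_le p hle)
      rw [coeff_modMonomial_of_not_le p hmx] at hm
      refine ((h₂ m).1 (hb0 m (mem_support_iff.2 hm))).resolve_right fun h => hmx ?_
      rw [Finsupp.single_le_iff]; omega

end MonomialIdeal

-- Koszul homology of quotients by monomial ideals.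

universe u v

variable {k : Type u} {σ : Type v} [Field k] {E E' E'' : Set (σ →₀ ℕ)} {x : σ} {L : List σ}

/-- Vanishing of the Koszul homology of `S / I` for a monomial ideal `I`. -/
def VanishMon (k : Type u) [Field k] (L : List σ) (E : Set (σ →₀ ℕ)) (i q : ℤ) : Prop :=
  Vanish (fun q => (quotientGrading (monIdeal k E) q).toAddSubgroup)
    (L.map (X : σ → MvPolynomial σ k)) i q

lemma raisesDegree_monIdeal (E : Set (σ →₀ ℕ)) :
    RaisesDegree (fun q => (quotientGrading (monIdeal k E) q).toAddSubgroup)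
      (L.map (X : σ → MvPolynomial σ k)) :=
  (isGraded_quotient (isHomogeneousIdeal_monIdeal E)).raisesDegree L

/-- The inductive form of `reg S/I ≤ max (reg S/(I:x) + 1, reg S/(I,x))`; the twist by `-1` turns
`q` into `q - 1`. -/
lemma VanishMon.of_colon (h₁ : ∀ m, Finsupp.single x 1 + m ∈ upSet E ↔ m ∈ upSet E')
    (h₂ : ∀ m, m ∈ upSet E'' ↔ m ∈ upSet E ∨ m x ≠ 0) {i q : ℤ}
    (h' : VanishMon k L E' i (q - 1)) (h'' : VanishMon k L E'' i q) : VanishMon k L E i q :=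
  vanish_middle (shortExactOn_monIdeal h₁ h₂) (raisesDegree_monIdeal E)
    ((vanish_shift (𝓜 := fun q => (quotientGrading (monIdeal k E') q).toAddSubgroup) (-1)).2 h') h''

lemma VanishMon.quotient (h₁ : ∀ m, Finsupp.single x 1 + m ∈ upSet E ↔ m ∈ upSet E')
    (h₂ : ∀ m, m ∈ upSet E'' ↔ m ∈ upSet E ∨ m x ≠ 0) {i q : ℤ}
    (h : VanishMon k L E i q) (h' : VanishMon k L E' (i - 1) q) : VanishMon k L E'' i q :=
  vanish_right (shortExactOn_monIdeal h₁ h₂) (raisesDegree_monIdeal E) h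
    ((vanish_shift (𝓜 := fun q => (quotientGrading (monIdeal k E') q).toAddSubgroup) (-1)).2
      (by rw [show q + 1 + -1 = q by ring]; exact h'))

lemma kos_eq_zero {S M : Type*} [CommRing S] [AddCommGroup M] [Module S M] [Subsingleton M] :
    ∀ (l : List S) (z : Kos M l), z = 0
  | [], z => Subsingleton.elim (α := M) z 0
  | _ :: l, _ => ext_fst_snd (kos_eq_zero l _) (kos_eq_zero l _)

/-- Here the quotient is `S` itself, its own minimal cover with zero kernel and a generator in
degree zero; its only homology is at `i = q = 0`. -/
lemma vanishMon_empty (hnd : L.Nodup) (hL : ∀ v, v ∈ L) (i : ℤ) {q : ℤ} (hq : 0 < q) :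
    VanishMon k L (∅ : Set (σ →₀ ℕ)) i q := by
  set I := monIdeal k (∅ : Set (σ →₀ ℕ)) with hI
  have hI0 : I = ⊥ := by rw [hI, monIdeal, Set.image_empty, Ideal.span_empty]
  let g : (Fin 1 → MvPolynomial σ k) →ₗ[MvPolynomial σ k] MvPolynomial σ k ⧸ I :=
    I.mkQ ∘ₗ LinearMap.proj 0
  have hg : ∀ f, g f = Ideal.Quotient.mk I (f 0) := fun f => rfl
  have hg0 : ∀ f, g f = 0 → f = 0 := fun f hf => by
    rw [hg, Ideal.Quotient.eq_zero_iff_mem, hI0] at hf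
    ext1 a
    rw [Subsingleton.elim a 0]; exact hf
  have hc : IsMinimalCover 0 (fun q => (quotientGrading I q).toAddSubgroup) g :=
    { map_mem := fun q f hf => mem_quotientGrading.2 ⟨f 0, by simpa using hf 0, rfl⟩
      lift := fun q m hm => by
        obtain ⟨p, hp, rfl⟩ := mem_quotientGrading.1 hm
        exact ⟨fun _ => p, fun a => by simpa using hp, rfl⟩
      minimal := fun f hf a => by rw [hg0 f hf]; exact zero_mem _ }
  rcases lt_trichotomy i 0 with hi | rfl | hi
  · exact vanish_of_neg hi
  · exact (hc.vanish_zero_iff hL).2 fun a => hq.ne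
  · have := (hc.vanish_succ_iff (p := i - 1) (q := q) hnd hL (by omega)).2 fun z hz dz => by
      have : Subsingleton (LinearMap.ker g) :=
        ⟨fun a b => Subtype.ext ((hg0 _ a.2).trans (hg0 _ b.2).symm)⟩
      exact ⟨0, zero_mem _, by rw [kos_eq_zero _ z, map_zero]⟩
    rwa [sub_add_cancel] at this

/-! ### Edge ideals of induced subgraphs -/

/-- The subgraph of `H` that consists of the edges contained in `U`. -/
def restr (H : SimpleGraph σ) (U : Set σ) : SimpleGraph σ where
  Adj u v := H.Adj u v ∧ u ∈ U ∧ v ∈ U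
  symm := ⟨fun _ _ h => ⟨h.1.symm, h.2.2, h.2.1⟩⟩
  loopless := ⟨fun _ h => H.irrefl h.1⟩

/-- The exponents of the monomials `x_u x_v`, for the edges `{u, v}` of `H`, and of the variables
in `A`. -/
def edgeExponents (H : SimpleGraph σ) (A : Set σ) : Set (σ →₀ ℕ) :=
  {s | ∃ u v, H.Adj u v ∧ s = Finsupp.single u 1 + Finsupp.single v 1} ∪
    {s | ∃ a ∈ A, s = Finsupp.single a 1}

lemma edgeIdeal_eq_monIdeal (H : SimpleGraph σ) :
    H.edgeIdeal k = monIdeal k (edgeExponents H ∅) := by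
  rw [SimpleGraph.edgeIdeal, monIdeal]
  congr 1
  ext p
  constructor
  · rintro ⟨u, v, h, rfl⟩
    exact ⟨_, Or.inl ⟨u, v, h, rfl⟩, by simp [X, monomial_mul]⟩
  · rintro ⟨s, ⟨u, v, h, rfl⟩ | ⟨a, ha, -⟩, rfl⟩
    · exact ⟨u, v, h, by simp [X, monomial_mul]⟩
    · exact ha.elim

lemma mem_upSet_edgeExponents {H : SimpleGraph σ} {A : Set σ} {m : σ →₀ ℕ} :
    m ∈ upSet (edgeExponents H A) ↔
      (∃ u v, H.Adj u v ∧ m u ≠ 0 ∧ m v ≠ 0) ∨ ∃ a ∈ A, m a ≠ 0 := by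
  classical
  constructor
  · rintro ⟨s, ⟨u, v, h, rfl⟩ | ⟨a, ha, rfl⟩, hs⟩
    · refine Or.inl ⟨u, v, h, ?_, ?_⟩
      · have := hs u; simp at this; omega
      · have := hs v; simp at this; omega
    · refine Or.inr ⟨a, ha, ?_⟩
      have := hs a; simp at this; omega
  · rintro (⟨u, v, h, hu, hv⟩ | ⟨a, ha, hm⟩)
    · refine ⟨_, Or.inl ⟨u, v, h, rfl⟩, fun w => ?_⟩
      have := h.ne
      simp only [Finsupp.add_apply, Finsupp.single_apply]
      split_ifs <;> subst_vars <;> first | omega | contradiction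
    · refine ⟨_, Or.inr ⟨a, ha, rfl⟩, ?_⟩
      rw [Finsupp.single_le_iff]; omega

lemma single_add_apply_ne_zero {x y : σ} {m : σ →₀ ℕ} :
    (Finsupp.single x 1 + m : σ →₀ ℕ) y ≠ 0 ↔ y = x ∨ m y ≠ 0 := by
  classical
  rw [Finsupp.add_apply, Finsupp.single_apply]
  split_ifs with h
  · simp [h]
  · simp [Ne.symm h]

/-- The ideal `(I(H_U) + (A)) : x` for a vertex `x` in `U`. -/
lemma colon_edgeExponents {H : SimpleGraph σ} {U A : Set σ} (hA : Disjoint U A) (hx : x ∈ U)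
    (m : σ →₀ ℕ) :
    Finsupp.single x 1 + m ∈ upSet (edgeExponents (restr H U) A) ↔
      m ∈ upSet (edgeExponents (restr H (U \ {y | y = x ∨ H.Adj x y})) (A ∪ {y ∈ U | H.Adj x y})) := by
  simp only [mem_upSet_edgeExponents, single_add_apply_ne_zero]
  constructor
  · rintro (⟨u, v, ⟨h, hu, hv⟩, hmu, hmv⟩ | ⟨a, ha, rfl | hm⟩)
    · by_cases hxu : H.Adj x u
      · exact Or.inr ⟨u, Or.inr ⟨hu, hxu⟩, hmu.resolve_left hxu.ne'⟩
      by_cases hxv : H.Adj x v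
      · exact Or.inr ⟨v, Or.inr ⟨hv, hxv⟩, hmv.resolve_left hxv.ne'⟩
      have hu' : u ≠ x := by rintro rfl; exact hxv h
      have hv' : v ≠ x := by rintro rfl; exact hxu h.symm
      refine Or.inl ⟨u, v, ⟨h, ⟨hu, ?_⟩, ⟨hv, ?_⟩⟩, hmu.resolve_left hu', hmv.resolve_left hv'⟩
      · rintro (h | h) <;> contradiction
      · rintro (h | h) <;> contradiction
    · exact (hA.ne_of_mem hx ha rfl).elim
    · exact Or.inr ⟨a, Or.inl ha, hm⟩
  · rintro (⟨u, v, ⟨h, hu, hv⟩, hmu, hmv⟩ | ⟨a, ha | ha, hm⟩)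
    · exact Or.inl ⟨u, v, ⟨h, hu.1, hv.1⟩, Or.inr hmu, Or.inr hmv⟩
    · exact Or.inr ⟨a, ha, Or.inr hm⟩
    · exact Or.inl ⟨x, a, ⟨ha.2, hx, ha.1⟩, Or.inl rfl, Or.inr hm⟩

/-- The ideal `(I(H_U) + (A), x)`. -/
lemma insert_edgeExponents {H : SimpleGraph σ} {U A : Set σ} (m : σ →₀ ℕ) :
    m ∈ upSet (edgeExponents (restr H (U \ {x})) (insert x A)) ↔
      m ∈ upSet (edgeExponents (restr H U) A) ∨ m x ≠ 0 := by
  simp only [mem_upSet_edgeExponents]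
  constructor
  · rintro (⟨u, v, ⟨h, hu, hv⟩, hmu, hmv⟩ | ⟨a, rfl | ha, hm⟩)
    · exact Or.inl (Or.inl ⟨u, v, ⟨h, hu.1, hv.1⟩, hmu, hmv⟩)
    · exact Or.inr hm
    · exact Or.inl (Or.inr ⟨a, ha, hm⟩)
  · rintro ((⟨u, v, ⟨h, hu, hv⟩, hmu, hmv⟩ | ⟨a, ha, hm⟩) | hm)
    · by_cases hxu : u = x
      · exact Or.inr ⟨x, Or.inl rfl, hxu ▸ hmu⟩
      by_cases hxv : v = x
      · exact Or.inr ⟨x, Or.inl rfl, hxv ▸ hmv⟩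
      exact Or.inl ⟨u, v, ⟨h, ⟨hu, hxu⟩, ⟨hv, hxv⟩⟩, hmu, hmv⟩
    · exact Or.inr ⟨a, Or.inr ha, hm⟩
    · exact Or.inr ⟨x, Or.inl rfl, hm⟩

/-- A variable `a` outside `A` is a non-zero-divisor modulo `(A)`, so the colon ideal is `(A)` again
and adding `a` creates no homology with `q > 0`. -/
lemma vanishMon_variables (hnd : L.Nodup) (hL : ∀ v, v ∈ L) {A : Set σ} (hA : A.Finite) {q : ℤ}
    (hq : 0 < q) : ∀ i : ℤ, VanishMon k L (edgeExponents (⊥ : SimpleGraph σ) A) i q := by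
  induction A, hA using Set.Finite.induction_on with
  | empty =>
    intro i
    have : edgeExponents (⊥ : SimpleGraph σ) ∅ = ∅ := by
      ext s; simp [edgeExponents]
    rw [this]
    exact vanishMon_empty hnd hL i hq
  | @insert a A ha _ ih =>
    intro i
    refine VanishMon.quotient (x := a) (fun m => ?_) (fun m => ?_) (ih i) (ih (i - 1))
    · simp only [mem_upSet_edgeExponents, single_add_apply_ne_zero, SimpleGraph.bot_adj,
        false_and, exists_false, false_or]
      refine exists_congr fun b => and_congr_right fun hb => ?_
      simp only [or_iff_right_iff_imp]
      rintro rfl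
      exact (ha hb).elim
    · simp [mem_upSet_edgeExponents, or_comm]

/-! ### Induced matchings -/

lemma mem_edgeSet_restr {H : SimpleGraph σ} {U : Set σ} {e : Sym2 σ} :
    e ∈ (restr H U).edgeSet ↔ e ∈ H.edgeSet ∧ ∀ v ∈ e, v ∈ U := by
  induction e using Sym2.ind with
  | _ a b => simp [restr]

lemma isInducedMatching_empty (H : SimpleGraph σ) : H.IsInducedMatching ∅ where
  subset_edgeSet := by simp
  disjoint := by simp
  induced e _ h := by
    induction e using Sym2.ind with
    | _ a b => obtain ⟨f, hf, -⟩ := h a (Sym2.mem_mk_left a b); simp at hf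

lemma IsInducedMatching.mono {H : SimpleGraph σ} {U U' : Set σ} (hU : U' ⊆ U) {M : Finset (Sym2 σ)}
    (h : (restr H U').IsInducedMatching M) : (restr H U).IsInducedMatching M where
  subset_edgeSet e he := by
    have := mem_edgeSet_restr.1 (h.subset_edgeSet e he)
    exact mem_edgeSet_restr.2 ⟨this.1, fun v hv => hU (this.2 v hv)⟩
  disjoint := h.disjoint
  induced e he hM := h.induced e (mem_edgeSet_restr.2 ⟨(mem_edgeSet_restr.1 he).1, fun v hv => by
    obtain ⟨f, hf, hvf⟩ := hM v hv
    exact (mem_edgeSet_restr.1 (h.subset_edgeSet f hf)).2 v hvf⟩) hM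

/-- An induced matching that avoids the closed neighbourhood of `x` can be extended by an edge
`{x, y}` if the neighbours of `y` are in the closed neighbourhood of `x`. -/
lemma IsInducedMatching.insert_edge [DecidableEq σ] {H : SimpleGraph σ} {U : Set σ} {x y : σ}
    (hx : x ∈ U) (hy : y ∈ U) (hxy : H.Adj x y) (hN : ∀ z, H.Adj y z → z = x ∨ H.Adj x z)
    {M : Finset (Sym2 σ)}
    (h : (restr H (U \ {z | z = x ∨ H.Adj x z})).IsInducedMatching M) :
    (restr H U).IsInducedMatching (insert s(x, y) M) ∧ s(x, y) ∉ M := by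
  have hM : ∀ e ∈ M, ∀ v ∈ e, v ∈ U ∧ v ≠ x ∧ ¬ H.Adj x v := fun e he v hv => by
    have := (mem_edgeSet_restr.1 (h.subset_edgeSet e he)).2 v hv
    exact ⟨this.1, fun h => this.2 (Or.inl h), fun h => this.2 (Or.inr h)⟩
  have hxM : ∀ e ∈ M, x ∉ e := fun e he hx => (hM e he x hx).2.1 rfl
  have hyM : ∀ e ∈ M, y ∉ e := fun e he hy => (hM e he y hy).2.2 hxy
  have hU := IsInducedMatching.mono Set.sdiff_subset h
  -- All neighbours of `x` and `y` lie in `N[x]`, which `M` avoids; so an edge from `x` or `y` to a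
  -- covered vertex can only be `{x, y}`.
  have key : ∀ a b, H.Adj a b → (a = x ∨ a = y) → (∃ f ∈ insert s(x, y) M, b ∈ f) →
      s(a, b) = s(x, y) := by
    rintro a b hab ha ⟨f, hf, hb⟩
    rcases Finset.mem_insert.1 hf with rfl | hf
    · rcases Sym2.mem_iff.1 hb with rfl | rfl
      · rcases ha with rfl | rfl
        · exact (H.irrefl hab).elim
        · exact Sym2.eq_swap
      · rcases ha with rfl | rfl
        · rfl
        · exact (H.irrefl hab).elim
    · have := hM f hf b hb
      rcases ha with rfl | rfl
      · exact (this.2.2 hab).elim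
      · rcases hN b hab with h | h
        · exact (this.2.1 h).elim
        · exact (this.2.2 h).elim
  refine ⟨⟨?_, ?_, ?_⟩, fun he => hxM _ he (Sym2.mem_mk_left x y)⟩
  · intro e he
    rcases Finset.mem_insert.1 he with rfl | he
    · exact ⟨hxy, hx, hy⟩
    · exact hU.subset_edgeSet e he
  · intro e he f hf hef v hv
    rcases Finset.mem_insert.1 he with he' | he' <;> rcases Finset.mem_insert.1 hf with hf' | hf'
    · exact hef (he'.trans hf'.symm)
    · rcases Sym2.mem_iff.1 (he' ▸ hv.1) with e | e
      · exact hxM f hf' (e ▸ hv.2)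
      · exact hyM f hf' (e ▸ hv.2)
    · rcases Sym2.mem_iff.1 (hf' ▸ hv.2) with e' | e'
      · exact hxM e he' (e' ▸ hv.1)
      · exact hyM e he' (e' ▸ hv.1)
    · exact h.disjoint e he' f hf' hef v hv
  · intro e he hcov
    induction e using Sym2.ind with
    | _ a b =>
      have hab : H.Adj a b := (mem_edgeSet_restr.1 he).1
      have ha := hcov a (Sym2.mem_mk_left a b)
      have hb := hcov b (Sym2.mem_mk_right a b)
      by_cases ha' : a = x ∨ a = y
      · rw [key a b hab ha' hb]; exact Finset.mem_insert_self _ _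
      by_cases hb' : b = x ∨ b = y
      · rw [@Sym2.eq_swap _ a b, key b a hab.symm hb' ha]; exact Finset.mem_insert_self _ _
      have aux : ∀ c, ¬ (c = x ∨ c = y) → (∃ f ∈ insert s(x, y) M, c ∈ f) → ∃ f ∈ M, c ∈ f := by
        rintro c hc ⟨f, hf, hcf⟩
        rcases Finset.mem_insert.1 hf with rfl | hf
        · exact (hc (Sym2.mem_iff.1 hcf)).elim
        · exact ⟨f, hf, hcf⟩
      refine Finset.mem_insert_of_mem (hU.induced _ he fun v hv => ?_)
      rcases Sym2.mem_iff.1 hv with rfl | rfl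
      · exact aux _ ha' ha
      · exact aux _ hb' hb

/-- Every vertex `x` in `C` has a neighbour `w x` outside `C` whose neighbours are in the closed
neighbourhood of `x`, and every edge meets `C`. -/
structure IsWhiskered (H : SimpleGraph σ) (C : Set σ) (w : σ → σ) : Prop where
  notMem : ∀ x ∈ C, w x ∉ C
  adj : ∀ x ∈ C, H.Adj x (w x)
  nbhd : ∀ x ∈ C, ∀ y, H.Adj (w x) y → y = x ∨ H.Adj x y
  cover : ∀ x y, H.Adj x y → x ∈ C ∨ y ∈ C

/-- The Koszul homology of `S / (I(H_U) + (A))` is bounded by the induced matching number. -/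
lemma IsWhiskered.vanishMon [Finite σ] (hnd : L.Nodup) (hL : ∀ v, v ∈ L) {H : SimpleGraph σ}
    {C : Set σ} {w : σ → σ} (h : IsWhiskered H C w) (N : ℕ) : ∀ (U A : Set σ) (ρ : ℤ),
    (U ∩ C).ncard = N → Disjoint U A → (∀ x ∈ U ∩ C, w x ∈ U) →
    (∀ M, (restr H U).IsInducedMatching M → (M.card : ℤ) ≤ ρ) → ∀ i q : ℤ, ρ < q →
    VanishMon k L (edgeExponents (restr H U) A) i q := by
  classical
  induction N using Nat.strong_induction_on with
  | _ N ih =>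
  intro U A ρ hN hA hw hρ i q hq
  by_cases hU : (U ∩ C) = ∅
  · have : restr H U = ⊥ := by
      ext a b
      simp only [SimpleGraph.bot_adj, iff_false]
      rintro ⟨hab, ha, hb⟩
      rcases h.cover a b hab with hc | hc
      · exact (hU ▸ (⟨ha, hc⟩ : a ∈ U ∩ C) : a ∈ (∅ : Set σ))
      · exact (hU ▸ (⟨hb, hc⟩ : b ∈ U ∩ C) : b ∈ (∅ : Set σ))
    rw [this]
    -- The empty matching gives `0 ≤ ρ`, hence `0 < q`.
    have h0 := hρ ∅ (isInducedMatching_empty _)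
    rw [Finset.card_empty] at h0
    exact vanishMon_variables hnd hL A.toFinite (by omega) i
  · obtain ⟨x, hxU, hxC⟩ := Set.nonempty_iff_ne_empty.2 hU
    have hlt : ∀ U' ⊆ U, x ∉ U' → (U' ∩ C).ncard < N := fun U' hU' hx => by
      rw [← hN]
      refine Set.ncard_lt_ncard ⟨Set.inter_subset_inter_left _ hU', fun hs => hx ?_⟩
      exact (hs ⟨hxU, hxC⟩).1
    refine VanishMon.of_colon (x := x) (colon_edgeExponents hA hxU) insert_edgeExponents ?_ ?_
    · refine ih _ (hlt (U \ {y | y = x ∨ H.Adj x y}) Set.sdiff_subset fun hx => hx.2 (Or.inl rfl))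
        (U \ {y | y = x ∨ H.Adj x y}) (A ∪ {y ∈ U | H.Adj x y}) (ρ - 1) rfl ?_ ?_ ?_ _ _
        (by omega)
      · rw [Set.disjoint_union_right]
        refine ⟨hA.mono_left Set.sdiff_subset, Set.disjoint_left.2 fun y hy hy' => ?_⟩
        exact hy.2 (Or.inr hy'.2)
      · rintro y ⟨⟨hyU, hyx⟩, hyC⟩
        refine ⟨hw y ⟨hyU, hyC⟩, ?_⟩
        rintro (hwy | hwy)
        · exact h.notMem y hyC (hwy ▸ hxC)
        · rcases h.nbhd y hyC x hwy.symm with e | e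
          · exact hyx (Or.inl e.symm)
          · exact hyx (Or.inr e.symm)
      · intro M hM
        obtain ⟨h1, h2⟩ := IsInducedMatching.insert_edge hxU (hw x ⟨hxU, hxC⟩) (h.adj x hxC)
          (h.nbhd x hxC) hM
        have := hρ _ h1
        rw [Finset.card_insert_of_notMem h2] at this
        push_cast at this
        omega
    · refine ih _ (hlt (U \ {x}) Set.sdiff_subset fun hx => hx.2 rfl) (U \ {x}) (insert x A) ρ rfl ?_ ?_ ?_ _ _ hq
      · rw [Set.disjoint_insert_right]
        exact ⟨fun hx => hx.2 rfl, hA.mono_left Set.sdiff_subset⟩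
      · rintro y ⟨⟨hyU, hyx⟩, hyC⟩
        exact ⟨hw y ⟨hyU, hyC⟩, fun e => h.notMem y hyC (e ▸ hxC)⟩
      · exact fun M hM => hρ M (IsInducedMatching.mono Set.sdiff_subset hM)

lemma restr_univ (H : SimpleGraph σ) : restr H Set.univ = H := by
  ext a b; simp [restr]

end GradedRes

/-! ## A Koszul homology class from an induced matching -/

namespace Koszul

/-- The list of the entries of the pairs in `P`, followed by `U`. -/
def pairList {α : Type*} : List (α × α) → List α → List α
  | [], U => U
  | p :: P, U => p.1 :: p.2 :: pairList P U

lemma map_pairList {α β : Type*} (f : α → β) (U : List α) :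
    ∀ P : List (α × α), (pairList P U).map f = pairList (P.map (Prod.map f f)) (U.map f)
  | [] => rfl
  | p :: P => by simp [pairList, map_pairList f U P]

lemma mem_pairList {α : Type*} {v : α} {U : List α} : ∀ {P : List (α × α)},
    v ∈ pairList P U ↔ (∃ p ∈ P, v = p.1 ∨ v = p.2) ∨ v ∈ U
  | [] => by simp [pairList]
  | p :: P => by simp [pairList, mem_pairList (P := P), or_assoc]

universe u v

variable {S : Type u} [CommRing S] {M T : Type v} [AddCommGroup M] [Module S M]
  [AddCommGroup T] [Module S T] {𝓜 : ℤ → AddSubgroup M}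

/-- The map `K(U; M) → T` that is `φ` in homological degree zero. -/
def lowFun (φ : M →ₗ[S] T) : ∀ U : List S, Kos M U → T
  | [] => φ
  | _ :: U => fun z => lowFun φ U (fst z)

/-- The map `K(pairList P U; M) → T` that picks one of the two basis elements of each pair. -/
def matchFun (φ : M →ₗ[S] T) (U : List S) : ∀ P : List (S × S), Kos M (pairList P U) → T
  | [] => lowFun φ U
  | p :: P => fun z : Kos M (p.1 :: p.2 :: pairList P U) =>
    matchFun φ U P (snd (fst z)) + matchFun φ U P (fst (snd z))

variable (φ : M →ₗ[S] T) {U : List S}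

lemma lowFun_add_smul (r : S) : ∀ (U : List S) (y z : Kos M U),
    lowFun φ U (y + r • z) = lowFun φ U y + r • lowFun φ U z
  | [], y, z => by
    exact (φ.map_add y (r • z)).trans (congrArg (φ y + ·) (φ.map_smul r z))
  | _ :: U, y, z => lowFun_add_smul r U (fst y) (fst z)

lemma matchFun_add_smul (r : S) : ∀ (P : List (S × S)) (y z : Kos M (pairList P U)),
    matchFun φ U P (y + r • z) = matchFun φ U P y + r • matchFun φ U P z
  | [], y, z => lowFun_add_smul φ r U y z
  | p :: P, y, z => by
    have h1 := matchFun_add_smul r P (snd (s := p.2) (fst (s := p.1) y)) (snd (fst z))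
    have h2 := matchFun_add_smul r P (fst (s := p.2) (snd (s := p.1) y)) (fst (snd z))
    show matchFun φ U P (snd (fst y) + r • snd (fst z)) +
      matchFun φ U P (fst (snd y) + r • fst (snd z)) = (_ + _) + r • (_ + _)
    rw [h1, h2, smul_add]; abel

lemma matchFun_zero (P : List (S × S)) : matchFun φ U P 0 = 0 := by
  have := matchFun_add_smul φ (U := U) (1 : S) P 0 0
  rwa [smul_zero, add_zero, one_smul, right_eq_add] at this

lemma matchFun_smul (P : List (S × S)) (r : S) (z : Kos M (pairList P U)) :
    matchFun φ U P (r • z) = r • matchFun φ U P z := by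
  have := matchFun_add_smul φ r P 0 z
  rwa [zero_add, matchFun_zero, zero_add] at this

lemma lowFun_d : ∀ {U : List S} (_ : ∀ s ∈ U, ∀ t : T, s • t = 0) (z : Kos M U),
    lowFun φ U (d U z) = 0
  | [], _, z => map_zero φ
  | s :: U, hU, z => by
    show lowFun φ U (d U (fst z) + s • snd z) = 0
    rw [lowFun_add_smul, lowFun_d (fun t ht => hU t (List.mem_cons_of_mem _ ht)),
      hU s List.mem_cons_self, add_zero]

/-- In the sum of the two selected coefficients of a boundary, the coefficient of `e_x e_y` enters
as `x - y`, which acts as zero on `T`; the rest are boundaries for the shorter list. In `lowFun_d`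
the remaining elements act as zero. -/
lemma matchFun_d (hU : ∀ s ∈ U, ∀ t : T, s • t = 0) : ∀ {P : List (S × S)}
    (_ : ∀ p ∈ P, ∀ t : T, p.1 • t = p.2 • t) (z : Kos M (pairList P U)),
    matchFun φ U P (d _ z) = 0
  | [], _, z => lowFun_d φ hU z
  | p :: P, hP, z => by
    have ih := matchFun_d hU fun p' hp' => hP p' (List.mem_cons_of_mem _ hp')
    let z' : Kos M (p.1 :: p.2 :: pairList P U) := z
    have h1 : snd (s := p.2) (fst (d (p.1 :: p.2 :: pairList P U) z')) =
        p.1 • snd (snd z') + (-1 : S) • d _ (snd (fst z')) := by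
      simp [add_comm]
    have h2 : fst (s := p.2) (snd (d (p.1 :: p.2 :: pairList P U) z')) =
        (-p.2) • snd (snd z') + (-1 : S) • d _ (fst (snd z')) := by
      simp [add_comm]
    show matchFun φ U P (snd (s := p.2) (fst (d (p.1 :: p.2 :: pairList P U) z'))) +
      matchFun φ U P (fst (s := p.2) (snd (d (p.1 :: p.2 :: pairList P U) z'))) = 0
    rw [h1, h2, matchFun_add_smul, matchFun_add_smul, ih, ih, matchFun_smul, matchFun_smul,
      hP p List.mem_cons_self, smul_zero, add_zero, add_zero, neg_smul, add_neg_cancel]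

/-- The element `∏ x e_y`, where `(x, y)` runs over the pairs in `P`. -/
def matchCycle (m : M) (U : List S) : ∀ P : List (S × S), Kos M (pairList P U)
  | [] => emb U m
  | p :: P => pair p.1 (pair p.2 0 (p.1 • matchCycle m U P)) 0

lemma smul_kos_eq_zero {r : S} (h : ∀ m : M, r • m = 0) : ∀ (l : List S) (z : Kos M l), r • z = 0
  | [], z => h z
  | _ :: l, _ => ext_fst_snd (smul_kos_eq_zero h l _) (smul_kos_eq_zero h l _)

/-- Each factor satisfies `d (x e_y) = y x`, which annihilates `M`. -/
lemma d_matchCycle (m : M) (U : List S) : ∀ {P : List (S × S)}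
    (_ : ∀ p ∈ P, ∀ n : M, (p.2 * p.1) • n = 0), d _ (matchCycle m U P) = 0
  | [], _ => d_emb U m
  | p :: P, hP => by
    have ih := d_matchCycle m U fun p' hp' => hP p' (List.mem_cons_of_mem _ hp')
    have h0 := smul_kos_eq_zero (hP p List.mem_cons_self) _ (matchCycle m U P)
    refine ext_fst_snd (s := p.1) (l := p.2 :: pairList P U) ?_ ?_
    · show d (p.2 :: pairList P U) (pair p.2 0 (p.1 • matchCycle m U P)) + p.1 • 0 = 0
      refine ext_fst_snd ?_ ?_
      · simp [smul_smul, h0]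
      · simp [ih]
    · show -d (p.2 :: pairList P U) 0 = 0
      rw [map_zero, neg_zero]

lemma matchCycle_mem_gr {m : M} (hm : m ∈ 𝓜 0) (U : List S) : ∀ {P : List (S × S)}
    (_ : ∀ p ∈ P, ∀ q, ∀ n ∈ 𝓜 q, p.1 • n ∈ 𝓜 (q + 1)),
    matchCycle m U P ∈ gr 𝓜 (pairList P U) P.length P.length
  | [], _ => (mem_gr_zero U).2 ⟨m, hm, rfl⟩
  | p :: P, hP => by
    have ih := matchCycle_mem_gr hm U fun p' hp' => hP p' (List.mem_cons_of_mem _ hp')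
    have := smul_mem_gr (hP p List.mem_cons_self) _ ih
    have e : (((p :: P).length : ℕ) : ℤ) = P.length + 1 := by simp
    rw [e]
    refine mem_gr_cons.2 ⟨mem_gr_cons.2 ⟨zero_mem _, ?_⟩, zero_mem _⟩
    show p.1 • matchCycle m U P ∈ _
    rwa [add_sub_cancel_right]

lemma lowFun_emb (m : M) : ∀ U : List S, lowFun φ U (emb U m) = φ m
  | [] => rfl
  | _ :: U => lowFun_emb m U

lemma matchFun_matchCycle (m : M) : ∀ P : List (S × S),
    matchFun φ U P (matchCycle m U P) = (P.map Prod.fst).prod • φ m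
  | [] => by
    rw [List.map_nil, List.prod_nil, one_smul]
    exact lowFun_emb φ m U
  | p :: P => by
    show matchFun φ U P (p.1 • matchCycle m U P) + matchFun φ U P 0 = _
    rw [matchFun_smul, matchFun_zero, add_zero, matchFun_matchCycle m P, smul_smul, List.map_cons,
      List.prod_cons]

/-- `matchFun` vanishes on boundaries and takes the value `∏ x • φ m ≠ 0` on the cycle `matchCycle`.
-/
lemma not_vanish_pairList {P : List (S × S)} (hU : ∀ s ∈ U, ∀ t : T, s • t = 0)
    (hT : ∀ p ∈ P, ∀ t : T, p.1 • t = p.2 • t) (hM : ∀ p ∈ P, ∀ n : M, (p.2 * p.1) • n = 0)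
    (hP : ∀ p ∈ P, ∀ q, ∀ n ∈ 𝓜 q, p.1 • n ∈ 𝓜 (q + 1)) {m : M} (hm : m ∈ 𝓜 0)
    (h : (P.map Prod.fst).prod • φ m ≠ 0) :
    ¬ Vanish 𝓜 (pairList P U) P.length P.length := by
  intro hv
  obtain ⟨w, -, hw⟩ := hv _ (matchCycle_mem_gr hm U hP) (d_matchCycle m U hM)
  rw [← matchFun_matchCycle (U := U), ← hw, matchFun_d φ hU hT] at h
  exact h rfl

end Koszul

/-! ### The detecting quotient of an induced matching. -/

namespace GradedRes

open MvPolynomial Koszul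

universe u v

variable {k : Type u} {σ : Type v} [Field k] {H : SimpleGraph σ} {M : Finset (Sym2 σ)}

/-- The variable of the edge in `M` that contains `v`, modulo squares; zero if there is none. -/
noncomputable def matchVar (k : Type u) [Field k] (M : Finset (Sym2 σ)) (v : σ) :
    MvPolynomial (Sym2 σ) k ⧸ monIdeal k {s | ∃ e : Sym2 σ, s = Finsupp.single e 2} :=
  open Classical in if h : ∃ e ∈ M, v ∈ e then Ideal.Quotient.mk _ (X h.choose) else 0

lemma matchVar_eq_zero {v : σ} (h : ∀ e ∈ M, v ∉ e) : matchVar k M v = 0 :=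
  dif_neg fun ⟨e, he, hv⟩ => h e he hv

lemma matchVar_eq (hM : H.IsInducedMatching M) {e : Sym2 σ} (he : e ∈ M) {v : σ} (hv : v ∈ e) :
    matchVar k M v = Ideal.Quotient.mk _ (X e) := by
  have h : ∃ e ∈ M, v ∈ e := ⟨e, he, hv⟩
  rw [matchVar, dif_pos h]
  congr 2
  by_contra hne
  exact hM.disjoint _ h.choose_spec.1 _ he hne v ⟨h.choose_spec.2, hv⟩

/-- The map from the polynomial ring on the vertices to the polynomial ring on the edges, modulo
squares, that sends the vertices of an edge in `M` to this edge. -/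
noncomputable def matchHom (k : Type u) [Field k] (M : Finset (Sym2 σ)) :
    MvPolynomial σ k →ₐ[k]
      MvPolynomial (Sym2 σ) k ⧸ monIdeal k {s | ∃ e : Sym2 σ, s = Finsupp.single e 2} :=
  aeval (matchVar k M)

/-- An edge with both ends covered belongs to `M`, as `M` is induced, and its monomial maps to a
square; any other edge has an end that maps to zero. -/
lemma edgeIdeal_le_ker_matchHom (hM : H.IsInducedMatching M) :
    H.edgeIdeal k ≤ RingHom.ker (matchHom k M) := by
  refine Ideal.span_le.2 ?_
  rintro _ ⟨u, v, huv, rfl⟩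
  rw [SetLike.mem_coe, RingHom.mem_ker, map_mul, matchHom, aeval_X, aeval_X]
  by_cases hu : ∃ e ∈ M, u ∈ e
  · by_cases hv : ∃ e ∈ M, v ∈ e
    · have he : s(u, v) ∈ M := hM.induced _ huv fun w hw => by
        rcases Sym2.mem_iff.1 hw with rfl | rfl
        · exact hu
        · exact hv
      rw [matchVar_eq hM he (Sym2.mem_mk_left u v), matchVar_eq hM he (Sym2.mem_mk_right u v),
        ← map_mul, Ideal.Quotient.eq_zero_iff_mem]
      exact Ideal.subset_span ⟨_, ⟨s(u, v), rfl⟩, by simp [X, monomial_mul, ← Finsupp.single_add]⟩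
    · push Not at hv
      rw [matchVar_eq_zero hv, mul_zero]
  · push Not at hu
    rw [matchVar_eq_zero hu, zero_mul]

/-- The product is a squarefree monomial, so no square of a variable divides it. -/
lemma prod_X_ne_zero (M : Finset (Sym2 σ)) :
    Ideal.Quotient.mk (monIdeal k {s | ∃ e : Sym2 σ, s = Finsupp.single e 2})
      (∏ e ∈ M, X e) ≠ 0 := by
  classical
  have e : (∏ e ∈ M, X e : MvPolynomial (Sym2 σ) k) =
      monomial (∑ e ∈ M, Finsupp.single e 1) 1 := by
    rw [monomial_sum_one]; rfl
  rw [Ne, Ideal.Quotient.eq_zero_iff_mem, e, mem_monIdeal]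
  intro h
  obtain ⟨_, ⟨f, rfl⟩, hf⟩ := h _ (by
    rw [mem_support_iff, coeff_monomial, if_pos rfl]; exact one_ne_zero)
  have := hf f
  rw [Finsupp.single_eq_same, Finsupp.finsetSum_apply] at this
  simp only [Finsupp.single_apply, Finset.sum_ite_eq'] at this
  split_ifs at this <;> omega

lemma mk_out_fst_snd (e : Sym2 σ) : s((Quot.out e).1, (Quot.out e).2) = e := Quot.out_eq e

lemma nodup_pairList_out {l : List (Sym2 σ)} {U : List σ} (hU : U.Nodup) (hl : l.Nodup)
    (hlU : ∀ e ∈ l, ∀ v ∈ e, v ∉ U) (hdiag : ∀ e ∈ l, ¬ e.IsDiag)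
    (hd : ∀ e ∈ l, ∀ f ∈ l, e ≠ f → ∀ v : σ, ¬ (v ∈ e ∧ v ∈ f)) :
    (pairList (l.map Quot.out) U).Nodup := by
  induction l with
  | nil => exact hU
  | cons e l ih =>
    have hmem : ∀ v ∈ e, v ∉ pairList (l.map Quot.out) U := by
      intro v hv h
      rcases mem_pairList.1 h with ⟨p, hp, hvp⟩ | h
      · obtain ⟨f, hf, rfl⟩ := List.mem_map.1 hp
        refine hd e List.mem_cons_self f (List.mem_cons_of_mem _ hf) ?_ v ⟨hv, ?_⟩
        · rintro rfl; exact (List.nodup_cons.1 hl).1 hf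
        · rw [← mk_out_fst_snd f]; exact Sym2.mem_iff.2 hvp
      · exact hlU e List.mem_cons_self v hv h
    refine List.nodup_cons.2 ⟨?_, List.nodup_cons.2 ⟨hmem _ e.out_snd_mem, ?_⟩⟩
    · rw [List.mem_cons, not_or]
      refine ⟨fun h => hdiag e List.mem_cons_self ?_, hmem _ e.out_fst_mem⟩
      rw [← mk_out_fst_snd e]; exact h
    · exact ih (List.nodup_cons.1 hl).2 (fun f hf => hlU f (List.mem_cons_of_mem _ hf))
        (fun f hf => hdiag f (List.mem_cons_of_mem _ hf))
        (fun f hf f' hf' => hd f (List.mem_cons_of_mem _ hf) f' (List.mem_cons_of_mem _ hf'))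

lemma isHomogeneousIdeal_edgeIdeal (H : SimpleGraph σ) : IsHomogeneousIdeal (H.edgeIdeal k) := by
  rw [edgeIdeal_eq_monIdeal]; exact isHomogeneousIdeal_monIdeal _

/-- An induced matching of size `m` gives a class in the Koszul homology of `S / I(H)` in
homological degree `m` and internal degree `2 m`. -/
theorem exists_not_vanish_of_isInducedMatching [Finite σ] (hM : H.IsInducedMatching M) :
    ∃ L : List σ, L.Nodup ∧ (∀ v, v ∈ L) ∧
      ¬ Vanish (fun q => (quotientGrading (H.edgeIdeal k) q).toAddSubgroup)
        (L.map (X : σ → MvPolynomial σ k)) M.card M.card := by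
  classical
  have := Fintype.ofFinite σ
  -- The variables are ordered with the matched pairs first and the uncovered vertices `U` last, as
  -- `matchCycle` and `matchFun` require.
  set P := M.toList.map Quot.out with hP
  set U := (Finset.univ.filter fun v : σ => ∀ e ∈ M, v ∉ e).toList with hUdef
  have hU : ∀ v, v ∈ U ↔ ∀ e ∈ M, v ∉ e := fun v => by simp [hUdef]
  have hPmem : ∀ p ∈ P, s(p.1, p.2) ∈ M := fun p hp => by
    obtain ⟨e, he, rfl⟩ := List.mem_map.1 hp
    rw [mk_out_fst_snd]; exact Finset.mem_toList.1 he
  refine ⟨pairList P U, ?_, fun v => ?_, ?_⟩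
  · refine nodup_pairList_out (Finset.nodup_toList _) (Finset.nodup_toList _) ?_ ?_ ?_
    · intro e he v hv h
      exact (hU v).1 h e (Finset.mem_toList.1 he) hv
    · intro e he
      exact H.not_isDiag_of_mem_edgeSet (hM.subset_edgeSet e (Finset.mem_toList.1 he))
    · intro e he f hf
      exact hM.disjoint e (Finset.mem_toList.1 he) f (Finset.mem_toList.1 hf)
  · rw [mem_pairList, hU]
    by_cases h : ∀ e ∈ M, v ∉ e
    · exact Or.inr h
    · push Not at h
      obtain ⟨e, he, hv⟩ := h
      refine Or.inl ⟨Quot.out e, List.mem_map.2 ⟨e, Finset.mem_toList.2 he, rfl⟩, ?_⟩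
      rwa [← mk_out_fst_snd e, Sym2.mem_iff] at hv
  · have hcard : M.card = (P.map (Prod.map (X : σ → MvPolynomial σ k) (X : σ → MvPolynomial σ k))).length := by
      simp [hP]
    rw [map_pairList, hcard]
    -- The target `T` is `S / ker`, on which a polynomial acts through its image under `matchHom`.
    have hker : ∀ (s t : MvPolynomial σ k), matchHom k M s = matchHom k M t →
        ∀ x : MvPolynomial σ k ⧸ RingHom.ker (matchHom k M), s • x = t • x := by
      intro s t h x
      obtain ⟨p, rfl⟩ := Ideal.Quotient.mk_surjective x
      show Ideal.Quotient.mk _ (s * p) = Ideal.Quotient.mk _ (t * p)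
      rw [Ideal.Quotient.eq, RingHom.mem_ker, map_sub, map_mul, map_mul, h, sub_self]
    have hX : ∀ v, matchHom k M (X v) = matchVar k M v := fun v => aeval_X _ _
    refine not_vanish_pairList (quotMap (edgeIdeal_le_ker_matchHom hM))
      (m := Ideal.Quotient.mk _ 1) ?_ ?_ ?_ ?_ ?_ ?_
    · intro s hs t
      obtain ⟨v, hv, rfl⟩ := List.mem_map.1 hs
      rw [hker (X v) 0 (by rw [hX, map_zero, matchVar_eq_zero ((hU v).1 hv)]), zero_smul]
    · intro p hp t
      obtain ⟨p, hp', rfl⟩ := List.mem_map.1 hp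
      refine hker (X p.1) (X p.2) ?_ t
      rw [hX, hX, matchVar_eq hM (hPmem p hp') (Sym2.mem_mk_left _ _),
        matchVar_eq hM (hPmem p hp') (Sym2.mem_mk_right _ _)]
    · intro p hp n
      obtain ⟨p, hp', rfl⟩ := List.mem_map.1 hp
      obtain ⟨n, rfl⟩ := Ideal.Quotient.mk_surjective n
      show Ideal.Quotient.mk _ (X p.2 * X p.1 * n) = 0
      rw [Ideal.Quotient.eq_zero_iff_mem]
      exact Ideal.mul_mem_right _ _ (Ideal.subset_span
        ⟨p.2, p.1, (hM.subset_edgeSet _ (hPmem p hp') : H.Adj p.1 p.2).symm, rfl⟩)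
    · intro p hp q n hn
      obtain ⟨p, hp', rfl⟩ := List.mem_map.1 hp
      exact ((isGraded_quotient (isHomogeneousIdeal_edgeIdeal H)).raisesDegree [p.1]) _
        (by simp) q n hn
    · exact mem_quotientGrading.2 ⟨1, isWeightedHomogeneous_one k _, rfl⟩
    · rw [quotMap_mk]
      show Ideal.Quotient.mk _ (_ * 1) ≠ 0
      rw [mul_one, Ne, Ideal.Quotient.eq_zero_iff_mem, RingHom.mem_ker, map_list_prod,
        List.map_map, List.map_map, hP, List.map_map]
      have : M.toList.map (((matchHom k M ∘ Prod.fst) ∘ Prod.map (X : σ → MvPolynomial σ k)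
          (X : σ → MvPolynomial σ k)) ∘ Quot.out) =
          M.toList.map fun e => Ideal.Quotient.mk
            (monIdeal k {s | ∃ e : Sym2 σ, s = Finsupp.single e 2}) (X e) := by
        refine List.map_congr_left fun e he => ?_
        show matchHom k M (X (Quot.out e).1) = _
        rw [hX]
        exact matchVar_eq hM (Finset.mem_toList.1 he) (Sym2.out_fst_mem e)
      rw [this, Finset.prod_map_toList, ← map_prod]
      exact prod_X_ne_zero M

end GradedRes

/-! ## The regularity of whiskered graphs -/

namespace GradedRes

open MvPolynomial Koszul

universe u v

variable {σ : Type v} [Finite σ] {H : SimpleGraph σ}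

lemma bddAbove_card_isInducedMatching (H : SimpleGraph σ) :
    BddAbove {m | ∃ M : Finset (Sym2 σ), H.IsInducedMatching M ∧ M.card = m} := by
  classical
  have := Fintype.ofFinite σ
  refine ⟨Fintype.card (Sym2 σ), ?_⟩
  rintro _ ⟨M, -, rfl⟩
  exact M.card_le_univ

lemma card_le_inducedMatchingNumber {M : Finset (Sym2 σ)} (hM : H.IsInducedMatching M) :
    M.card ≤ H.inducedMatchingNumber := by
  rw [SimpleGraph.inducedMatchingNumber]
  exact le_csSup (bddAbove_card_isInducedMatching H) ⟨M, hM, rfl⟩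

lemma exists_card_eq_inducedMatchingNumber (H : SimpleGraph σ) :
    ∃ M : Finset (Sym2 σ), H.IsInducedMatching M ∧ M.card = H.inducedMatchingNumber := by
  have hne : {m | ∃ M : Finset (Sym2 σ), H.IsInducedMatching M ∧ M.card = m}.Nonempty :=
    ⟨0, ∅, isInducedMatching_empty H, rfl⟩
  exact Nat.sSup_mem hne (bddAbove_card_isInducedMatching H)

/-- The regularity of the edge ideal of a whiskered graph is the induced matching number. -/
theorem IsWhiskered.isRegularity {k : Type u} [Field k] {C : Set σ} {w : σ → σ}
    (h : IsWhiskered H C w) :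
    IsRegularity k σ (quotientGrading (H.edgeIdeal k)) (H.inducedMatchingNumber : ℤ) := by
  have hI := isHomogeneousIdeal_edgeIdeal (k := k) H
  refine ⟨nonempty_minimalGradedFreeResolution hI (Ideal.span_le.2 ?_), fun F => ?_⟩
  · rintro _ ⟨u, v, -, rfl⟩
    exact Ideal.mul_mem_right _ _ (Ideal.subset_span ⟨u, rfl⟩)
  obtain ⟨M, hM, hcard⟩ := exists_card_eq_inducedMatchingNumber H
  -- The ordering `L` of the variables adapted to `M` also serves for the upper bound, which holds
  -- for every ordering.
  obtain ⟨L, hnd, hL, hv⟩ := exists_not_vanish_of_isInducedMatching (k := k) hM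
  have hF := fun p q => F.vanish_iff_betti_eq_zero hnd hL (isGraded_quotient hI) p q
  constructor
  · exact ⟨M.card, M.card + M.card, fun h0 => hv ((hF _ _).2 h0), by rw [hcard]; ring⟩
  · rintro _ ⟨i, j, hij, rfl⟩
    by_contra! hlt
    refine hij ?_
    rw [← sub_add_cancel j (i : ℤ), ← hF, edgeIdeal_eq_monIdeal, ← restr_univ H]
    refine h.vanishMon hnd hL _ Set.univ ∅ H.inducedMatchingNumber rfl (Set.disjoint_empty _)
      (fun _ _ => trivial) (fun M hM => ?_) i _ hlt
    rw [restr_univ] at hM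
    exact_mod_cast card_le_inducedMatchingNumber hM

end GradedRes

namespace SimpleGraph.IsCliquePartition

variable {V : Type*} {G : SimpleGraph V} {r : ℕ} {W : Fin r → Set V}

lemma exists_mem (hW : G.IsCliquePartition W) (x : V) : ∃ i, x ∈ W i := by
  rw [← Set.mem_iUnion, hW.iUnion_eq]; trivial

lemma eq_or_adj (hW : G.IsCliquePartition W) {x y : V} {i : Fin r} (hx : x ∈ W i) (hy : y ∈ W i) :
    y = x ∨ G.Adj x y := by
  by_cases h : y = x
  · exact Or.inl h
  · exact Or.inr (hW.isClique i hx hy (Ne.symm h))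

/-- The whisker of `x` is a new vertex over a part containing `x`; its neighbours form a clique
through `x`, hence lie in `N[x]`. Two new vertices are never adjacent, so the old ones cover all
edges. -/
lemma isWhiskered_multiCliqueWhiskered (hW : G.IsCliquePartition W) {n : Fin r → ℕ}
    (hn : ∀ i, 0 < n i) : ∃ w, GradedRes.IsWhiskered (G.multiCliqueWhiskered W n)
      (Set.range Sum.inl) w := by
  choose c hc using hW.exists_mem
  refine ⟨Sum.elim (fun x => Sum.inr ⟨c x, 0, hn _⟩) Sum.inr, ⟨?_, ?_, ?_, ?_⟩⟩
  · rintro _ ⟨x, rfl⟩ ⟨y, hy⟩; simp at hy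
  · rintro _ ⟨x, rfl⟩; exact hc x
  · rintro _ ⟨x, rfl⟩ (y | y) hy
    · rcases hW.eq_or_adj (hc x) hy with rfl | h
      · exact Or.inl rfl
      · exact Or.inr h
    · exact hy.elim
  · rintro (x | x) (y | y) h
    · exact Or.inl ⟨x, rfl⟩
    · exact Or.inl ⟨x, rfl⟩
    · exact Or.inr ⟨y, rfl⟩
    · exact h.elim

lemma isWhiskered_cliqueWhiskered (hW : G.IsCliquePartition W) :
    ∃ w, GradedRes.IsWhiskered (G.cliqueWhiskered W) (Set.range Sum.inl) w := by
  choose c hc using hW.exists_mem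
  refine ⟨Sum.elim (fun x => Sum.inr (c x)) Sum.inr, ⟨?_, ?_, ?_, ?_⟩⟩
  · rintro _ ⟨x, rfl⟩ ⟨y, hy⟩; simp at hy
  · rintro _ ⟨x, rfl⟩; exact hc x
  · rintro _ ⟨x, rfl⟩ (y | y) hy
    · rcases hW.eq_or_adj (hc x) hy with rfl | h
      · exact Or.inl rfl
      · exact Or.inr h
    · exact hy.elim
  · rintro (x | x) (y | y) h
    · exact Or.inl ⟨x, rfl⟩
    · exact Or.inl ⟨x, rfl⟩
    · exact Or.inr ⟨y, rfl⟩
    · exact h.elim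

end SimpleGraph.IsCliquePartition

theorem mainTheorem5 {k : Type*} [Field k] {V : Type*} [Finite V] (G : SimpleGraph V)
    {r : ℕ} (W : Fin r → Set V) (hW : G.IsCliquePartition W) :
    (∀ n : Fin r → ℕ, (∀ i, 0 < n i) →
      GradedRes.IsRegularity k (V ⊕ (Σ i : Fin r, Fin (n i)))
        (GradedRes.quotientGrading ((G.multiCliqueWhiskered W n).edgeIdeal k))
        ((G.multiCliqueWhiskered W n).inducedMatchingNumber : ℤ)) ∧
    GradedRes.IsRegularity k (V ⊕ Fin r)
      (GradedRes.quotientGrading ((G.cliqueWhiskered W).edgeIdeal k))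
      ((G.cliqueWhiskered W).inducedMatchingNumber : ℤ) := by
  refine ⟨fun n hn => ?_, ?_⟩
  · obtain ⟨w, hw⟩ := hW.isWhiskered_multiCliqueWhiskered hn
    exact hw.isRegularity
  · obtain ⟨w, hw⟩ := hW.isWhiskered_cliqueWhiskered
    exact hw.isRegularity
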